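/- **Conventions.** A cube complex $X$ is a CW-complex obtained by gluing cubes of arbitrary finite dimensions by isometries along their faces (no connectedness, compactness or bound on the dimension is assumed). Two oriented edges are parallel if they are opposite, identically oriented sides of a square; an oriented hyperplane is a class of oriented edges for the equivalence relation generated by parallelism, $J^{-1}$ denotes $J$ with the opposite orientation, and a hyperplane is the analogous class of unoriented edges. Two oriented edges with the same origin generate a square if they are the two sides of some square at one of its corners. Two hyperplanes are transverse if they are dual to non-parallel sides of some square. The crossing graph $\Delta X$ has the hyperplanes as vertices, and its edges link distinct transverse hyperplanes. $X$ is special if the link of each of its vertices is a simplicial flag complex, every hyperplane is two-sided ($J\neq J^{-1}$ for every oriented hyperplane $J$), no hyperplane is transverse to itself, no two distinct oriented edges dual to the same oriented hyperplane have the same origin (resp. the same endpoint) without (resp. without their inverses) generating a square, and no two edges dual to distinct transverse hyperplanes have a common endpoint without generating, when both are oriented away from it, a square. For a simplicial graph $\Delta$, $A(\Delta)=\langle V(\Delta)\mid ab=ba \text{ for adjacent } a,b\rangle$ is the right-angled Artin group. A special coloring $(\Delta,\phi)$ of $X$ is a simplicial graph $\Delta$ with a map $\phi$ from the oriented hyperplanes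 of $X$ to the set of colors $V(\Delta)\sqcup V(\Delta)^{-1}$ such that: $\phi(J^{-1})=\phi(J)^{-1}$; transverse oriented hyperplanes have adjacent colors (colors being adjacent when the underlying vertices of $\Delta$ are); distinct oriented edges with the same origin have dual oriented hyperplanes with distinct colors; two oriented edges with the same origin whose dual oriented hyperplanes have adjacent colors generate a square. For a vertex $x$, a word of colors is $x$-legal, with terminus $y$, if it is read along some path of the one-skeleton of $X$ from $x$ to $y$ (the terminus is unique). Two $x$-legal words are equivalent if one is obtained from the other by finitely many insertions or deletions of subwords $cc^{-1}$ ($c$ a color) and exchanges $cd\to dc$ of adjacent colors, all intermediate words being $x$-legal. $\mathcal D(X,x)$ is the group, under concatenation, of equivalence classes of $x$-legal words with terminus $x$ (spherical diagrams). **Theorem.** Let $X$ be a special cube complex. 1. Let $(\Delta,\phi)$ be a special coloring of $X$. For every vertex $x\in X$, the canonical morphism $\mathcal D(X,x)\to A(\Delta)$, sending the class of a word to the element of $A(\Delta)$ it represents, is injective; and there is an isomorphism $\mathcal D(X,x)\cong\pi_1(X,x)$ (with $\pi_1$ multiplied by concatenation) sending the class of the word read along a closed path $\gamma$ of the one-skeleton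 based at $x$ to the homotopy class of $\gamma$. In particular, for every $p\in X$, there is an injective morphism $\pi_1(X,p)\to A(\Delta)$. 2. For every $p\in X$, there is an injective morphism $\pi_1(X,p)\to A(\Delta X)$. -/

import Mathlib

open scoped unitInterval

universe u v

namespace CubeCx

/-- The interior of the `n`-dimensional cube `[0,1]ⁿ` (a point when `n = 0`). -/
def openCube (n : ℕ) : Set (Fin n → I) := {t | ∀ i, t i ∈ Set.Ioo (0 : I) 1}

/-- The isometric embeddings of the cube `[0,1]ᵐ` onto the `m`-dimensional faces of `[0,1]ⁿ`:
each coordinate of the source is sent, possibly after the reflection `t ↦ 1 - t`, to its own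
coordinate of the target, and the remaining coordinates of the target are constant, `0` or `1`.
For `m = n` these are the isometries of the cube `[0,1]ⁿ`. -/
def IsFaceMap {m n : ℕ} (f : (Fin m → I) → (Fin n → I)) : Prop :=
  ∃ e : Fin m ↪ Fin n,
    (∀ i, (∀ x, f x (e i) = x i) ∨ (∀ x, f x (e i) = σ (x i))) ∧
    (∀ j, j ∉ Set.range e → (∀ x, f x j = 0) ∨ (∀ x, f x j = 1))

/-- The structure of a cube complex on a topological space `X`: a CW-complex obtained by gluing
cubes of arbitrary finite dimensions by isometries along their faces. It is recorded through the
set of all the parametrized cubes, ie. all the maps `[0,1]ⁿ → X` obtained by composing the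
characteristic map of some `n`-dimensional cube of `X` with an isometry of `[0,1]ⁿ`. No
connectedness, finiteness or bound on the dimension is assumed, and the boundary of a cube may be
glued to itself. -/
structure CubeComplex (X : Type u) [TopologicalSpace X] where
  /-- The parametrized `n`-cubes. -/
  IsCube : ∀ n : ℕ, ((Fin n → I) → X) → Prop
  /-- The restriction of a cube to one of its faces is a cube, and cubes may be reparametrized by
  isometries. -/
  comp_face : ∀ {m n : ℕ} (c : (Fin n → I) → X) (f : (Fin m → I) → (Fin n → I)),
    IsCube n c → IsFaceMap f → IsCube m (c ∘ f)
  /-- The characteristic maps are injective on the open cubes. -/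
  injOn : ∀ {n : ℕ} (c : (Fin n → I) → X), IsCube n c → Set.InjOn c (openCube n)
  /-- Two open cubes which meet coincide: as `s` and `t` are interior points, the map `g` below
  is an isometry between cubes of the same dimension. -/
  eq_of_meet : ∀ {m n : ℕ} (c : (Fin m → I) → X) (d : (Fin n → I) → X),
    IsCube m c → IsCube n d → ∀ s ∈ openCube m, ∀ t ∈ openCube n, c s = d t →
      ∃ g : (Fin m → I) → (Fin n → I), IsFaceMap g ∧ g s = t ∧ c = d ∘ g
  /-- The open cubes cover the space. -/
  cover : ∀ x : X, ∃ (n : ℕ) (c : (Fin n → I) → X), IsCube n c ∧ ∃ t ∈ openCube n, c t = x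
  /-- The space carries the weak topology defined by the cubes. -/
  isOpen_iff : ∀ U : Set X,
    IsOpen U ↔ ∀ (n : ℕ) (c : (Fin n → I) → X), IsCube n c → IsOpen (c ⁻¹' U)

/-! ### Some faces and symmetries of cubes -/

/-- The edge of `[0,1]ⁿ` starting from the corner `0` in the `i`-th direction. -/
def axis {n : ℕ} (i : Fin n) (x : Fin 1 → I) : Fin n → I := Function.update (fun _ => 0) i (x 0)

/-- The side of `[0,1]²` opposite to `axis 0`. -/
def top (x : Fin 1 → I) : Fin 2 → I := ![x 0, 1]

/-- The reversal of `[0,1]`. -/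
def rev (x : Fin 1 → I) : Fin 1 → I := fun i => σ (x i)

/-- The diagonal symmetry of the square. -/
def diag (x : Fin 2 → I) : Fin 2 → I := ![x 1, x 0]

/-- The reflection of the square in the first direction. -/
def flip (x : Fin 2 → I) : Fin 2 → I := ![σ (x 0), x 1]

theorem isFaceMap_axis {n : ℕ} (i : Fin n) : IsFaceMap (axis i) := by
  refine ⟨⟨fun _ => i, fun a b _ => Subsingleton.elim a b⟩, fun k => Or.inl fun x => ?_,
    fun j hj => Or.inl fun x => ?_⟩
  · change axis i x i = x k
    simp [axis, Subsingleton.elim k 0]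
  · have : j ≠ i := fun h => hj ⟨0, h.symm⟩
    simp [axis, this]

theorem isFaceMap_top : IsFaceMap top := by
  refine ⟨⟨fun _ => 0, fun a b _ => Subsingleton.elim a b⟩, fun k => Or.inl fun x => ?_,
    fun j hj => Or.inr fun x => ?_⟩
  · change top x 0 = x k
    simp [top, Subsingleton.elim k 0]
  · have : j ≠ 0 := fun h => hj ⟨0, h.symm⟩
    obtain rfl : j = 1 := by omega
    simp [top]

theorem isFaceMap_rev : IsFaceMap rev :=
  ⟨Function.Embedding.refl _, fun _ => Or.inr fun _ => rfl, fun j hj => (hj ⟨j, rfl⟩).elim⟩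

theorem isFaceMap_diag : IsFaceMap diag := by
  refine ⟨(Equiv.swap (0 : Fin 2) 1).toEmbedding, fun k => Or.inl fun x => ?_,
    fun j hj => (hj ⟨Equiv.swap (0 : Fin 2) 1 j, by simp⟩).elim⟩
  fin_cases k <;> simp [diag]

theorem isFaceMap_flip : IsFaceMap flip := by
  refine ⟨Function.Embedding.refl _, fun k => ?_, fun j hj => (hj ⟨j, rfl⟩).elim⟩
  fin_cases k
  · exact Or.inr fun x => by simp [flip]
  · exact Or.inl fun x => by simp [flip]

namespace CubeComplex

variable {X : Type u} [TopologicalSpace X] (K : CubeComplex X)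

/-- The parametrized `n`-cubes of a cube complex. -/
def Cube (n : ℕ) : Type u := {c : (Fin n → I) → X // K.IsCube n c}

/-- The oriented edges of a cube complex are its parametrized `1`-cubes. -/
abbrev Edge : Type u := K.Cube 1

/-- The vertices of a cube complex are its `0`-cubes, viewed as points. -/
def IsVertex (x : X) : Prop := ∃ c : K.Cube 0, c.1 (fun _ => 0) = x

variable {K}

/-- Restriction of a cube to a face. -/
def Cube.face {m n : ℕ} (c : K.Cube n) (f : (Fin m → I) → (Fin n → I)) (hf : IsFaceMap f) :
    K.Cube m :=
  ⟨c.1 ∘ f, K.comp_face c.1 f c.2 hf⟩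

/-- The corner of a parametrized cube which is the image of `0`. -/
def Cube.corner {n : ℕ} (c : K.Cube n) : X := c.1 (fun _ => 0)

/-- The oriented edge of a parametrized cube starting from `c.corner` in the `i`-th direction. -/
def Cube.edge {n : ℕ} (c : K.Cube n) (i : Fin n) : K.Edge := c.face (axis i) (isFaceMap_axis i)

/-- In a parametrized square, the oriented edge which is opposite, and parallel, to the oriented
edge `q.edge 0`. -/
def Cube.opp (q : K.Cube 2) : K.Edge := q.face top isFaceMap_top

/-- The oriented edge with the opposite orientation. -/
def Cube.inv (e : K.Edge) : K.Edge := e.face rev isFaceMap_rev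

/-- The origin of an oriented edge. -/
def Cube.src (e : K.Edge) : X := e.1 (fun _ => 0)

/-- The endpoint of an oriented edge. -/
def Cube.tgt (e : K.Edge) : X := e.1 (fun _ => 1)

variable (K)

/-- Two oriented edges are parallel sides of some square. -/
def Parallel (e f : K.Edge) : Prop := ∃ q : K.Cube 2, q.edge 0 = e ∧ q.opp = f

/-- Two oriented edges with the same origin generate a square: they are the two sides at some
corner of a square. -/
def SpanSquare (e f : K.Edge) : Prop := ∃ q : K.Cube 2, q.edge 0 = e ∧ q.edge 1 = f

/-- Oriented hyperplanes: classes of oriented edges under the equivalence relation generated by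
parallelism. -/
def OrientedHyperplane : Type u := Quot K.Parallel

/-- Hyperplanes: classes of unoriented edges under the equivalence relation generated by
parallelism. -/
def Hyperplane : Type u := Quot fun e f : K.Edge => K.Parallel e f ∨ f = e.inv

variable {K}

/-- The oriented hyperplane dual to an oriented edge. -/
def Cube.orientedHyperplane (e : K.Edge) : K.OrientedHyperplane := Quot.mk _ e

/-- The hyperplane dual to an edge. -/
def Cube.hyperplane (e : K.Edge) : K.Hyperplane := Quot.mk _ e

theorem Parallel.inv {e f : K.Edge} (h : K.Parallel e f) : K.Parallel e.inv f.inv := by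
  obtain ⟨q, rfl, rfl⟩ := h
  refine ⟨q.face flip isFaceMap_flip, ?_, ?_⟩
  · refine Subtype.ext (funext fun x => congrArg q.1 (funext fun j => ?_))
    fin_cases j <;> simp [flip, axis, rev]
  · refine Subtype.ext (funext fun x => congrArg q.1 (funext fun j => ?_))
    fin_cases j <;> simp [flip, top, rev]

/-- The same hyperplane with the opposite orientation. -/
def OrientedHyperplane.inv : K.OrientedHyperplane → K.OrientedHyperplane :=
  Quot.map Cube.inv fun _ _ h => h.inv

/-- The hyperplane underlying an oriented hyperplane. -/
def OrientedHyperplane.toHyperplane : K.OrientedHyperplane → K.Hyperplane :=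
  Quot.map id fun _ _ h => Or.inl h

variable (K)

/-- Two hyperplanes are transverse if they are dual to non-parallel sides of some square. -/
def Transverse (J H : K.Hyperplane) : Prop :=
  ∃ q : K.Cube 2, (q.edge 0).hyperplane = J ∧ (q.edge 1).hyperplane = H

theorem Transverse.symm {J H : K.Hyperplane} (h : K.Transverse J H) : K.Transverse H J := by
  obtain ⟨q, rfl, rfl⟩ := h
  refine ⟨q.face diag isFaceMap_diag, ?_, ?_⟩
  · refine congrArg Cube.hyperplane (Subtype.ext (funext fun x => congrArg q.1 (funext fun j => ?_)))
    fin_cases j <;> simp [diag, axis]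
  · refine congrArg Cube.hyperplane (Subtype.ext (funext fun x => congrArg q.1 (funext fun j => ?_)))
    fin_cases j <;> simp [diag, axis]

/-- The crossing graph: its vertices are the hyperplanes, and its edges link two distinct
hyperplanes which are transverse. -/
def crossingGraph : SimpleGraph K.Hyperplane where
  Adj J H := J ≠ H ∧ K.Transverse J H
  symm := ⟨fun _ _ h => ⟨h.1.symm, h.2.symm⟩⟩
  loopless := ⟨fun _ h => h.1 rfl⟩

/-- Nonpositive curvature: the link of every vertex `v` is a simplicial flag complex. The vertices
of the link are the oriented edges `e` starting from `v`, and its simplices are the corners at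
`v` of cubes, ie. the parametrized cubes `c` with `c.corner = v` up to permutations of the
coordinates. The first two conditions say that the link is a simplicial complex (the vertices of a
simplex are distinct, and they determine the simplex), the last one that it is flag. -/
structure NonpositivelyCurved : Prop where
  edge_injective : ∀ {n : ℕ} (c : K.Cube n), Function.Injective c.edge
  eq_of_edge_eq : ∀ {n : ℕ} (c d : K.Cube n), c.corner = d.corner →
    (∀ i, c.edge i = d.edge i) → c = d
  flag : ∀ v : X, K.IsVertex v → ∀ {n : ℕ} (e : Fin n → K.Edge), (∀ i, (e i).src = v) →
    (∀ i j, i ≠ j → K.SpanSquare (e i) (e j)) →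
    ∃ c : K.Cube n, c.corner = v ∧ ∀ i, c.edge i = e i

variable {K}

/-- A hyperplane is two-sided if it differs from itself with the opposite orientation. -/
def OrientedHyperplane.TwoSided (J : K.OrientedHyperplane) : Prop := J ≠ J.inv

/-- Some square has two non-parallel sides dual to `J`. -/
def Hyperplane.SelfIntersecting (J : K.Hyperplane) : Prop := K.Transverse J J

/-- Two distinct oriented edges dual to `J` have the same origin, or the same endpoint, but are
not the two sides of a square at this vertex. -/
def OrientedHyperplane.SelfOsculating (J : K.OrientedHyperplane) : Prop :=
  ∃ e f : K.Edge, e ≠ f ∧ e.orientedHyperplane = J ∧ f.orientedHyperplane = J ∧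
    ((e.src = f.src ∧ ¬ K.SpanSquare e f) ∨ (e.tgt = f.tgt ∧ ¬ K.SpanSquare e.inv f.inv))

/-- `J` and `H` are transverse, and two edges dual to `J` and `H` respectively have a common
endpoint but are not the two sides of a square at this vertex. -/
def Hyperplane.InterOsculating (J H : K.Hyperplane) : Prop :=
  K.Transverse J H ∧ ∃ e f : K.Edge, e.hyperplane = J ∧ f.hyperplane = H ∧ e.src = f.src ∧
    ¬ K.SpanSquare e f

variable (K)

/-- Special cube complexes. -/
structure IsSpecial : Prop where
  nonpositivelyCurved : K.NonpositivelyCurved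
  twoSided : ∀ J : K.OrientedHyperplane, J.TwoSided
  not_selfIntersecting : ∀ J : K.Hyperplane, ¬ J.SelfIntersecting
  not_selfOsculating : ∀ J : K.OrientedHyperplane, ¬ J.SelfOsculating
  not_interOsculating : ∀ J H : K.Hyperplane, J ≠ H → ¬ J.InterOsculating H

/-! ### Edge-paths -/

/-- The list `γ` of oriented edges is a path in the one-skeleton from `x` to `y`. -/
def IsPath : X → List K.Edge → X → Prop
  | x, [], y => x = y
  | x, e :: γ, y => e.src = x ∧ IsPath e.tgt γ y

variable {K}

theorem Cube.continuous {n : ℕ} (c : K.Cube n) : Continuous c.1 :=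
  continuous_def.2 fun U hU => (K.isOpen_iff U).1 hU n c.1 c.2

/-- An oriented edge, as a continuous path in the topological space `X`. -/
def Cube.toPath (e : K.Edge) : Path e.src e.tgt where
  toFun t := e.1 (fun _ => t)
  continuous_toFun := e.continuous.comp (continuous_pi fun _ => continuous_id)
  source' := rfl
  target' := rfl

/-- The continuous path in the topological space `X` which follows successively the edges of a
path in the one-skeleton. -/
noncomputable def IsPath.toPath : ∀ {x : X} {γ : List K.Edge} {y : X}, K.IsPath x γ y → Path x y
  | x, [], _, h => (Path.refl x).cast rfl (Eq.symm h)
  | _, e :: _, _, h => (e.toPath.cast h.1.symm rfl).trans (IsPath.toPath h.2)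

end CubeComplex

/-! ### Right-angled Artin groups -/

/-- The right-angled Artin group `A(Δ)`: the generators are the vertices of `Δ`, the relations
say that adjacent vertices commute. -/
abbrev RAAG {V : Type v} (Δ : SimpleGraph V) : Type v :=
  PresentedGroup {r : FreeGroup V | ∃ a b : V, Δ.Adj a b ∧ r = .of a * .of b * (.of a)⁻¹ * (.of b)⁻¹}

/-- The disjoint union of `V` and `V⁻¹`: `(a, true)` stands for `a` and `(a, false)` stands for
`a⁻¹`. -/
abbrev Color (V : Type v) : Type v := V × Bool

/-- The involution `a ↔ a⁻¹` of the disjoint union of `V` and `V⁻¹`. -/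
def Color.inv {V : Type v} (c : Color V) : Color V := (c.1, !c.2)

/-- The element of `A(Δ)` represented by a letter. -/
def Color.toRAAG {V : Type v} (Δ : SimpleGraph V) (c : Color V) : RAAG Δ :=
  if c.2 then PresentedGroup.of c.1 else (PresentedGroup.of c.1)⁻¹

namespace CubeComplex

variable {X : Type u} [TopologicalSpace X]

/-- A special coloring `(Δ, φ)` of a cube complex. Two colors are adjacent when the underlying
vertices of `Δ` are adjacent. -/
structure SpecialColoring (K : CubeComplex X) {V : Type v} (Δ : SimpleGraph V) where
  /-- The coloring map. -/
  φ : K.OrientedHyperplane → Color V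
  map_inv : ∀ J, φ J.inv = (φ J).inv
  adj_of_transverse : ∀ J H : K.OrientedHyperplane,
    K.Transverse J.toHyperplane H.toHyperplane → Δ.Adj (φ J).1 (φ H).1
  /-- Distinct oriented edges starting from a given vertex have distinct colors. -/
  eq_of_color_eq : ∀ e f : K.Edge, e.src = f.src →
    φ e.orientedHyperplane = φ f.orientedHyperplane → e = f
  spanSquare_of_adj : ∀ e f : K.Edge, e.src = f.src →
    Δ.Adj (φ e.orientedHyperplane).1 (φ f.orientedHyperplane).1 → K.SpanSquare e f

/-- The elementary transformations of words of colors. -/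
inductive Move {V : Type v} (Δ : SimpleGraph V) : List (Color V) → List (Color V) → Prop
  | cancellation (u w : List (Color V)) (c : Color V) : Move Δ (u ++ c :: c.inv :: w) (u ++ w)
  | insertion (u w : List (Color V)) (c : Color V) : Move Δ (u ++ w) (u ++ c :: c.inv :: w)
  | commutation (u w : List (Color V)) (c d : Color V) (h : Δ.Adj c.1 d.1) :
      Move Δ (u ++ c :: d :: w) (u ++ d :: c :: w)

namespace SpecialColoring

variable {K : CubeComplex X} {V : Type v} {Δ : SimpleGraph V} (φ : K.SpecialColoring Δ)

/-- The color of an oriented edge. -/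
def color (e : K.Edge) : Color V := φ.φ e.orientedHyperplane

/-- The word `w` is `x`-legal with terminus `y`: it is read along some path from `x` to `y`. -/
def IsLegal (x : X) (w : List (Color V)) (y : X) : Prop :=
  ∃ γ : List K.Edge, K.IsPath x γ y ∧ γ.map φ.color = w

/-- An elementary transformation between two `x`-legal words. -/
def LegalMove (x : X) (w w' : List (Color V)) : Prop :=
  (∃ y, φ.IsLegal x w y) ∧ (∃ y, φ.IsLegal x w' y) ∧ Move Δ w w'

/-- The equivalence of `x`-legal words: there is a sequence of elementary transformations from one
to the other all of whose intermediate words are `x`-legal. -/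
def Equivalent (x : X) : List (Color V) → List (Color V) → Prop :=
  Relation.EqvGen (φ.LegalMove x)

/-- The `x`-legal words with terminus `x`, up to equivalence of `x`-legal words. -/
def diagramSetoid (x : X) : Setoid {w : List (Color V) // φ.IsLegal x w x} where
  r a b := φ.Equivalent x a.1 b.1
  iseqv := ⟨fun _ => .refl _, fun h => h.symm _ _, fun h h' => h.trans _ _ _ h'⟩

/-- The set `𝒟(X,x)` of spherical diagrams based at `x`. -/
def Diagram (x : X) : Type v := Quotient (φ.diagramSetoid x)

theorem src_inv (e : K.Edge) : e.inv.src = e.tgt :=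
  congrArg e.1 (funext fun _ => by simp [rev])

theorem tgt_inv (e : K.Edge) : e.inv.tgt = e.src :=
  congrArg e.1 (funext fun _ => by simp [rev])

theorem color_inv (e : K.Edge) : φ.color e.inv = (φ.color e).inv :=
  φ.map_inv e.orientedHyperplane

theorem inv_inv (c : Color V) : c.inv.inv = c := by simp [Color.inv]

theorem isLegal_nil {x y : X} : φ.IsLegal x [] y ↔ x = y := by
  constructor
  · rintro ⟨γ, h, hw⟩
    obtain rfl : γ = [] := by simpa using hw
    exact h
  · exact fun h => ⟨[], h, rfl⟩

theorem isLegal_cons {x y : X} {c : Color V} {w : List (Color V)} :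
    φ.IsLegal x (c :: w) y ↔ ∃ e : K.Edge, e.src = x ∧ φ.color e = c ∧ φ.IsLegal e.tgt w y := by
  constructor
  · rintro ⟨γ, h, hw⟩
    cases γ with
    | nil => simp at hw
    | cons e γ =>
      simp only [List.map_cons, List.cons.injEq] at hw
      exact ⟨e, h.1, hw.1, γ, h.2, hw.2⟩
  · rintro ⟨e, rfl, rfl, γ, h, rfl⟩
    exact ⟨e :: γ, ⟨rfl, h⟩, rfl⟩

theorem isLegal_append {x z : X} {u w : List (Color V)} :
    φ.IsLegal x (u ++ w) z ↔ ∃ y, φ.IsLegal x u y ∧ φ.IsLegal y w z := by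
  induction u generalizing x with
  | nil => simp [isLegal_nil]
  | cons c u ih =>
    simp only [List.cons_append, isLegal_cons, ih]
    constructor
    · rintro ⟨e, h1, h2, y, h3, h4⟩
      exact ⟨y, ⟨e, h1, h2, h3⟩, h4⟩
    · rintro ⟨y, ⟨e, h1, h2, h3⟩, h4⟩
      exact ⟨e, h1, h2, y, h3, h4⟩

/-- The terminus of a legal word is unique. -/
theorem IsLegal.unique {x y z : X} {w : List (Color V)} (h : φ.IsLegal x w y)
    (h' : φ.IsLegal x w z) : y = z := by
  induction w generalizing x with
  | nil => exact ((φ.isLegal_nil).1 h).symm.trans ((φ.isLegal_nil).1 h')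
  | cons c w ih =>
    obtain ⟨e, he, hc, h⟩ := (φ.isLegal_cons).1 h
    obtain ⟨f, hf, hd, h'⟩ := (φ.isLegal_cons).1 h'
    obtain rfl := φ.eq_of_color_eq e f (he.trans hf.symm) (hc.trans hd.symm)
    exact ih h h'

theorem isLegal_pair {x y : X} {c : Color V} : φ.IsLegal x [c, c.inv] y → x = y := by
  simp only [isLegal_cons, isLegal_nil]
  rintro ⟨e, rfl, rfl, f, hf, hc, rfl⟩
  obtain rfl := φ.eq_of_color_eq f e.inv (hf.trans (src_inv e).symm)
    (hc.trans (φ.color_inv e).symm)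
  exact (tgt_inv e).symm

theorem isLegal_swap {x y z : X} {c d : Color V} (hcd : Δ.Adj c.1 d.1)
    (h : φ.IsLegal x [c, d] y) (h' : φ.IsLegal x [d, c] z) : y = z := by
  simp only [isLegal_cons, isLegal_nil] at h h'
  obtain ⟨e, rfl, rfl, f, hf, rfl, rfl⟩ := h
  obtain ⟨f', hf', hd, e', he', hc, rfl⟩ := h'
  obtain ⟨q, rfl, rfl⟩ := φ.spanSquare_of_adj e f' hf'.symm (by
    change Δ.Adj _ (φ.color f').1
    rw [hd]
    exact hcd)
  have key : K.Parallel (q.edge 1) (q.face diag isFaceMap_diag).opp := by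
    refine ⟨q.face diag isFaceMap_diag, ?_, rfl⟩
    refine Subtype.ext (funext fun x => congrArg q.1 (funext fun j => ?_))
    fin_cases j <;> simp [diag, axis]
  have key' : K.Parallel (q.edge 0) q.opp := ⟨q, rfl, rfl⟩
  have h1 : f = (q.face diag isFaceMap_diag).opp := by
    refine φ.eq_of_color_eq _ _ (hf.trans ?_) (hd.symm.trans (congrArg φ.φ (Quot.sound key)))
    refine congrArg q.1 (funext fun j => ?_)
    fin_cases j <;> simp [diag, axis, top]
  have h2 : e' = q.opp := by
    refine φ.eq_of_color_eq _ _ (he'.trans ?_) (hc.trans (congrArg φ.φ (Quot.sound key')))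
    refine congrArg q.1 (funext fun j => ?_)
    fin_cases j <;> simp [axis, top]
  rw [h1, h2]
  refine congrArg q.1 (funext fun j => ?_)
  fin_cases j <;> simp [diag, top]

/-- Equivalent legal words have the same terminus. -/
theorem LegalMove.isLegal_iff {x : X} {w w' : List (Color V)} (h : φ.LegalMove x w w') (y : X) :
    φ.IsLegal x w y ↔ φ.IsLegal x w' y := by
  suffices H : ∀ y y', φ.IsLegal x w y → φ.IsLegal x w' y' → y = y' by
    obtain ⟨⟨a, ha⟩, ⟨b, hb⟩, -⟩ := h
    obtain rfl := H a b ha hb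
    constructor
    · intro h
      rwa [H y a h hb]
    · intro h
      rwa [← H a y ha h]
  obtain ⟨-, -, h⟩ := h
  have canc : ∀ (u w : List (Color V)) (c : Color V) (y y' : X),
      φ.IsLegal x (u ++ c :: c.inv :: w) y → φ.IsLegal x (u ++ w) y' → y = y' := by
    intro u w c y y' h h'
    obtain ⟨a, ha, h⟩ := (φ.isLegal_append).1 h
    obtain ⟨a', ha', h'⟩ := (φ.isLegal_append).1 h'
    obtain rfl := ha.unique φ ha'
    obtain ⟨b, hb, h⟩ := (φ.isLegal_append (u := [c, c.inv])).1 h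
    obtain rfl := φ.isLegal_pair hb
    exact h.unique φ h'
  intro y y' hy hy'
  cases h with
  | cancellation u w c => exact canc u w c y y' hy hy'
  | insertion u w c => exact (canc u w c y' y hy' hy).symm
  | commutation u w c d hcd =>
    obtain ⟨a, ha, h⟩ := (φ.isLegal_append).1 hy
    obtain ⟨a', ha', h'⟩ := (φ.isLegal_append).1 hy'
    obtain rfl := ha.unique φ ha'
    obtain ⟨b, hb, h⟩ := (φ.isLegal_append (u := [c, d])).1 h
    obtain ⟨b', hb', h'⟩ := (φ.isLegal_append (u := [d, c])).1 h'
    obtain rfl := φ.isLegal_swap hcd hb hb'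
    exact h.unique φ h'

theorem Equivalent.isLegal_iff {x : X} {w w' : List (Color V)} (h : φ.Equivalent x w w') (y : X) :
    φ.IsLegal x w y ↔ φ.IsLegal x w' y := by
  induction h with
  | rel _ _ h => exact h.isLegal_iff φ y
  | refl _ => exact Iff.rfl
  | symm _ _ _ ih => exact ih.symm
  | trans _ _ _ _ _ ih ih' => exact ih.trans ih'

theorem Move.append_left {w w' : List (Color V)} (h : Move Δ w w') (a : List (Color V)) :
    Move Δ (a ++ w) (a ++ w') := by
  cases h with
  | cancellation u w c => simpa using Move.cancellation (Δ := Δ) (a ++ u) w c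
  | insertion u w c => simpa using Move.insertion (Δ := Δ) (a ++ u) w c
  | commutation u w c d h => simpa using Move.commutation (Δ := Δ) (a ++ u) w c d h

theorem Move.append_right {w w' : List (Color V)} (h : Move Δ w w') (a : List (Color V)) :
    Move Δ (w ++ a) (w' ++ a) := by
  cases h with
  | cancellation u w c => simpa using Move.cancellation (Δ := Δ) u (w ++ a) c
  | insertion u w c => simpa using Move.insertion (Δ := Δ) u (w ++ a) c
  | commutation u w c d h => simpa using Move.commutation (Δ := Δ) u (w ++ a) c d h

/-- The formal inverse of a word of colors. -/
def invWord (w : List (Color V)) : List (Color V) := (w.map Color.inv).reverse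

theorem Move.invWord {w w' : List (Color V)} (h : Move Δ w w') :
    Move Δ (invWord w) (invWord w') := by
  cases h with
  | cancellation u w c =>
    simpa [SpecialColoring.invWord, inv_inv] using
      Move.cancellation (Δ := Δ) (SpecialColoring.invWord w) (SpecialColoring.invWord u) c
  | insertion u w c =>
    simpa [SpecialColoring.invWord, inv_inv] using
      Move.insertion (Δ := Δ) (SpecialColoring.invWord w) (SpecialColoring.invWord u) c
  | commutation u w c d h =>
    simpa [SpecialColoring.invWord] using
      Move.commutation (Δ := Δ) (SpecialColoring.invWord w) (SpecialColoring.invWord u)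
        d.inv c.inv h.symm

theorem IsLegal.invWord {x y : X} {w : List (Color V)} (h : φ.IsLegal x w y) :
    φ.IsLegal y (invWord w) x := by
  induction w generalizing x with
  | nil => exact (φ.isLegal_nil).2 ((φ.isLegal_nil).1 h).symm
  | cons c w ih =>
    obtain ⟨e, rfl, rfl, h'⟩ := (φ.isLegal_cons).1 h
    have : φ.IsLegal e.tgt [(φ.color e).inv] e.src :=
      (φ.isLegal_cons).2 ⟨e.inv, src_inv e, φ.color_inv e, (φ.isLegal_nil).2 (tgt_inv e)⟩
    simpa [SpecialColoring.invWord] using (φ.isLegal_append).2 ⟨_, ih h', this⟩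

theorem IsLegal.append {x y z : X} {u w : List (Color V)} (h : φ.IsLegal x u y)
    (h' : φ.IsLegal y w z) : φ.IsLegal x (u ++ w) z :=
  (φ.isLegal_append).2 ⟨y, h, h'⟩

theorem Equivalent.append_left {x y : X} {a w w' : List (Color V)} (ha : φ.IsLegal y a x)
    (h : φ.Equivalent x w w') : φ.Equivalent y (a ++ w) (a ++ w') := by
  induction h with
  | rel _ _ h =>
    obtain ⟨⟨b, hb⟩, ⟨c, hc⟩, h⟩ := h
    exact .rel _ _ ⟨⟨b, ha.append φ hb⟩, ⟨c, ha.append φ hc⟩, Move.append_left h a⟩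
  | refl _ => exact .refl _
  | symm _ _ _ ih => exact .symm _ _ ih
  | trans _ _ _ _ _ ih ih' => exact .trans _ _ _ ih ih'

theorem Equivalent.append_right {x y z : X} {a w w' : List (Color V)} (ha : φ.IsLegal y a z)
    (h : φ.Equivalent x w w') (hw : φ.IsLegal x w y) :
    φ.Equivalent x (w ++ a) (w' ++ a) := by
  induction h with
  | rel _ _ h =>
    exact .rel _ _ ⟨⟨z, hw.append φ ha⟩, ⟨z, ((h.isLegal_iff φ y).1 hw).append φ ha⟩,
      Move.append_right h.2.2 a⟩
  | refl _ => exact .refl _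
  | symm _ _ h ih => exact .symm _ _ (ih ((Equivalent.isLegal_iff φ h y).2 hw))
  | trans _ _ _ h _ ih ih' =>
    exact .trans _ _ _ (ih hw) (ih' ((Equivalent.isLegal_iff φ h y).1 hw))

theorem Equivalent.invWord {x y : X} {w w' : List (Color V)}
    (h : φ.Equivalent x w w') (hw : φ.IsLegal x w y) :
    φ.Equivalent y (invWord w) (invWord w') := by
  induction h with
  | rel _ _ h =>
    exact .rel _ _ ⟨⟨x, hw.invWord φ⟩, ⟨x, ((h.isLegal_iff φ y).1 hw).invWord φ⟩,
      Move.invWord h.2.2⟩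
  | refl _ => exact .refl _
  | symm _ _ h ih => exact .symm _ _ (ih ((Equivalent.isLegal_iff φ h y).2 hw))
  | trans _ _ _ h _ ih ih' =>
    exact .trans _ _ _ (ih hw) (ih' ((Equivalent.isLegal_iff φ h y).1 hw))

theorem equivalent_invWord_append {x y : X} {w : List (Color V)} (h : φ.IsLegal x w y) :
    φ.Equivalent y (invWord w ++ w) [] := by
  induction w generalizing x with
  | nil => exact .refl _
  | cons c w ih =>
    obtain ⟨e, he, hc, h'⟩ := (φ.isLegal_cons).1 h
    refine .trans _ _ _ (.rel _ _ ⟨⟨y, (h.invWord φ).append φ h⟩,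
      ⟨y, (h'.invWord φ).append φ h'⟩, ?_⟩) (ih h')
    simpa [SpecialColoring.invWord, inv_inv] using
      Move.cancellation (Δ := Δ) (SpecialColoring.invWord w) w c.inv

/-- The group structure on `𝒟(X,x)` given by the concatenation of words. -/
instance (x : X) : Group (φ.Diagram x) where
  mul := Quotient.map₂ (fun a b => ⟨a.1 ++ b.1, a.2.append φ b.2⟩)
    fun a a' h b b' h' => .trans _ _ _ (Equivalent.append_right φ b.2 h a.2)
      (Equivalent.append_left φ a'.2 h')
  one := Quotient.mk _ ⟨[], (φ.isLegal_nil).2 rfl⟩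
  inv := Quotient.map (fun a => ⟨invWord a.1, a.2.invWord φ⟩)
    fun a _ h => Equivalent.invWord φ h a.2
  mul_assoc := by
    rintro ⟨a⟩ ⟨b⟩ ⟨c⟩
    exact congrArg (Quotient.mk _) (Subtype.ext (List.append_assoc _ _ _))
  one_mul := by
    rintro ⟨a⟩
    rfl
  mul_one := by
    rintro ⟨a⟩
    exact congrArg (Quotient.mk _) (Subtype.ext (List.append_nil _))
  inv_mul_cancel := by
    rintro ⟨a⟩
    exact Quotient.sound (φ.equivalent_invWord_append a.2)

/-- The spherical diagram represented by a closed path of the one-skeleton. -/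
def diagramOfPath {x : X} {γ : List K.Edge} (h : K.IsPath x γ x) : φ.Diagram x :=
  Quotient.mk _ ⟨γ.map φ.color, γ, h, rfl⟩

/-- The element of `A(Δ)` represented by a word of colors. -/
def wordToRAAG (Δ : SimpleGraph V) (w : List (Color V)) : RAAG Δ :=
  (w.map (Color.toRAAG Δ)).prod

theorem toRAAG_inv (c : Color V) : c.inv.toRAAG Δ = (c.toRAAG Δ)⁻¹ := by
  obtain ⟨a, _ | _⟩ := c <;> simp [Color.inv, Color.toRAAG]

theorem commute_toRAAG {c d : Color V} (h : Δ.Adj c.1 d.1) :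
    Commute (c.toRAAG Δ) (d.toRAAG Δ) := by
  have key : Commute (PresentedGroup.of c.1 : RAAG Δ) (PresentedGroup.of d.1) := by
    have := PresentedGroup.one_of_mem (rels := {r : FreeGroup V | ∃ a b : V, Δ.Adj a b ∧
      r = .of a * .of b * (.of a)⁻¹ * (.of b)⁻¹}) ⟨c.1, d.1, h, rfl⟩
    simp only [map_mul] at this
    exact commutatorElement_eq_one_iff_commute.1 this
  unfold Color.toRAAG
  split_ifs <;> simpa using key

theorem wordToRAAG_eq {w w' : List (Color V)} (h : Move Δ w w') :
    wordToRAAG Δ w = wordToRAAG Δ w' := by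
  cases h with
  | cancellation u w c => simp [wordToRAAG, toRAAG_inv]
  | insertion u w c => simp [wordToRAAG, toRAAG_inv]
  | commutation u w c d h =>
    simp only [wordToRAAG, List.map_append, List.map_cons, List.prod_append, List.prod_cons]
    rw [← mul_assoc (c.toRAAG Δ), (commute_toRAAG h).eq, mul_assoc]

/-- The canonical morphism `𝒟(X,x) → A(Δ)`, sending the diagram represented by a word of colors to
the element of `A(Δ)` represented by the same word. -/
def diagramToRAAG (x : X) : φ.Diagram x →* RAAG Δ where
  toFun := Quotient.lift (fun a => wordToRAAG Δ a.1) fun a b h => by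
    change Relation.EqvGen _ _ _ at h
    generalize a.1 = a at h
    generalize b.1 = b at h
    induction h with
    | rel _ _ h => exact wordToRAAG_eq h.2.2
    | refl _ => rfl
    | symm _ _ _ ih => exact ih.symm
    | trans _ _ _ _ _ ih ih' => exact ih.trans ih'
  map_one' := rfl
  map_mul' := by
    rintro ⟨a⟩ ⟨b⟩
    change wordToRAAG Δ (a.1 ++ b.1) = wordToRAAG Δ a.1 * wordToRAAG Δ b.1
    simp [wordToRAAG]

end SpecialColoring
end CubeComplex
end CubeCx

namespace CubeCx

/-! ### Face maps -/

/-! Injectivity of `𝒟(X,x) → A(Δ)` is a word problem. A word that is trivial in `A(Δ)` can be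
brought to the empty word by cancellations and commutations alone, without insertions
(`reduces_nil_of_wordToRAAG_eq_one`). These two operations preserve legality (`Reduction.isLegal`):
after an edge `e`, the only edge whose color is inverse to that of `e` is `e.inv`, and two
consecutive edges with adjacent colors lie in a square, around whose other side the path can be
pushed. So a legal word that is trivial in `A(Δ)` is already trivial as a diagram
(`diagramToRAAG_injective`).

For the comparison with `π₁`, a diagram is sent to the homotopy class of a path reading it. This is
well defined because a legal move changes the path by a backtrack or across a square
(`pathHomotopic_of_equivalent`). It is onto by cellular approximation of paths (`isEdgePath`): open
stars contract along segments, so every path is homotopic to a concatenation of paths contained in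
cubes, and the junctions of these pieces can be pushed to vertices.

Its injectivity is obtained without cellular approximation of homotopies. The colors define an
`A(Δ)`-valued cocycle on `X` (`holonomy`), hence a covering with fiber `A(Δ)`
(`isQuotientCoveringMap_proj`) in which an edge path lifts to a path that multiplies the fiber
coordinate by the element of `A(Δ)` it reads. Homotopic paths have lifts with the same endpoint, so
they read the same element of `A(Δ)` (`wordToRAAG_eq_of_homotopic`), and injectivity of `𝒟(X,x) →
A(Δ)` concludes.

The second assertion is the first one applied to the coloring by hyperplanes (`IsSpecial.coloring`),
where a choice of orientations provides the signs and each axiom of a coloring excludes one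
pathology of hyperplanes. Arbitrary basepoints are joined to a vertex by a path inside a cube. -/

theorem IsFaceMap.id (n : ℕ) : IsFaceMap (fun x : Fin n → I => x) :=
  ⟨.refl _, fun _ => .inl fun _ => rfl, fun j hj => (hj ⟨j, rfl⟩).elim⟩

theorem IsFaceMap.comp {m n p : ℕ} {g : (Fin n → I) → (Fin p → I)} {f : (Fin m → I) → (Fin n → I)}
    (hg : IsFaceMap g) (hf : IsFaceMap f) : IsFaceMap (g ∘ f) := by
  obtain ⟨e, he, hc⟩ := hf
  obtain ⟨e', he', hc'⟩ := hg
  refine ⟨e.trans e', fun i => ?_, fun j hj => ?_⟩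
  · rcases he i with h | h <;> rcases he' (e i) with h' | h' <;> simp [h, h']
  · by_cases hj' : j ∈ Set.range e'
    · obtain ⟨k, rfl⟩ := hj'
      have hk : k ∉ Set.range e := by
        rintro ⟨i, rfl⟩
        exact hj ⟨i, rfl⟩
      rcases hc k hk with h | h <;> rcases he' k with h' | h' <;> simp [h, h']
    · rcases hc' j hj' with h | h <;> simp [h]

/-- A coordinate of a face map is a coordinate of its argument, possibly reflected, or constant. -/
theorem IsFaceMap.coord {m n : ℕ} {f : (Fin m → I) → (Fin n → I)} (hf : IsFaceMap f) (j : Fin n) :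
    (∃ i, ∀ x, f x j = x i) ∨ (∃ i, ∀ x, f x j = σ (x i)) ∨
      (∀ x, f x j = 0) ∨ (∀ x, f x j = 1) := by
  obtain ⟨e, he, hc⟩ := hf
  by_cases hj : j ∈ Set.range e
  · obtain ⟨k, rfl⟩ := hj
    rcases he k with h | h
    · exact .inl ⟨k, h⟩
    · exact .inr (.inl ⟨k, h⟩)
  · exact .inr (.inr (hc j hj))

theorem IsFaceMap.continuous {m n : ℕ} {f : (Fin m → I) → (Fin n → I)} (hf : IsFaceMap f) :
    Continuous f := by
  refine continuous_pi fun j => ?_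
  rcases hf.coord j with ⟨i, h⟩ | ⟨i, h⟩ | h | h <;> simp only [h] <;> fun_prop

/-! ### Metric and affine structure of cubes. -/

theorem unitInterval_dist_symm (a b : I) : dist (σ a) (σ b) = dist a b := by
  rw [Subtype.dist_eq, Subtype.dist_eq, Real.dist_eq, Real.dist_eq]
  rw [unitInterval.coe_symm_eq, unitInterval.coe_symm_eq, abs_sub_comm]
  congr 1
  ring

theorem IsFaceMap.dist_eq {m n : ℕ} {f : (Fin m → I) → (Fin n → I)} (hf : IsFaceMap f)
    (x y : Fin m → I) : dist (f x) (f y) = dist x y := by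
  refine le_antisymm ((dist_pi_le_iff dist_nonneg).2 fun j => ?_)
    ((dist_pi_le_iff dist_nonneg).2 fun i => ?_)
  · rcases hf.coord j with ⟨i, h⟩ | ⟨i, h⟩ | h | h
    · rw [h, h]
      exact dist_le_pi_dist x y i
    · rw [h, h, unitInterval_dist_symm]
      exact dist_le_pi_dist x y i
    · rw [h, h, dist_self]
      exact dist_nonneg
    · rw [h, h, dist_self]
      exact dist_nonneg
  · obtain ⟨e, he, -⟩ := hf
    refine le_trans ?_ (dist_le_pi_dist (f x) (f y) (e i))
    rcases he i with h | h
    · rw [h, h]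
    · rw [h, h, unitInterval_dist_symm]

/-- The point at time `τ` of the segment from `a` to `b` in a cube. -/
noncomputable def segment {n : ℕ} (a b : Fin n → I) (τ : I) : Fin n → I :=
  fun i => Set.Icc.convexComb (a i) (b i) τ

theorem continuous_convexComb :
    Continuous fun p : I × I × I => Set.Icc.convexComb p.1 p.2.1 p.2.2 := by
  refine Continuous.subtype_mk ?_ _
  fun_prop

theorem continuous_segment {n : ℕ} :
    Continuous fun p : (Fin n → I) × (Fin n → I) × I => segment p.1 p.2.1 p.2.2 := by
  refine continuous_pi fun i => ?_
  exact continuous_convexComb.comp (by fun_prop :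
    Continuous fun p : (Fin n → I) × (Fin n → I) × I => (p.1 i, p.2.1 i, p.2.2))

@[simp] theorem segment_zero {n : ℕ} (a b : Fin n → I) : segment a b 0 = a := by
  ext i; simp [segment]

@[simp] theorem segment_one {n : ℕ} (a b : Fin n → I) : segment a b 1 = b := by
  ext i; simp [segment]

theorem IsFaceMap.segment {m n : ℕ} {f : (Fin m → I) → (Fin n → I)} (hf : IsFaceMap f)
    (a b : Fin m → I) (τ : I) : f (segment a b τ) = segment (f a) (f b) τ := by
  ext j
  rcases hf.coord j with ⟨i, h⟩ | ⟨i, h⟩ | h | h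
  · simp [CubeCx.segment, h]
  · simp only [CubeCx.segment, h, Set.Icc.coe_convexComb, unitInterval.coe_symm_eq]
    ring
  · simp [CubeCx.segment, h]
  · simp [CubeCx.segment, h]

/-- The straight path between two points of a cube. -/
noncomputable def segmentPath {n : ℕ} (a b : Fin n → I) : Path a b where
  toFun := segment a b
  continuous_toFun := continuous_segment.comp
    (by fun_prop : Continuous fun τ : I => ((a, b, τ) : (Fin n → I) × (Fin n → I) × I))
  source' := segment_zero a b
  target' := segment_one a b

/-- Contractibility makes cubes simply connected, which is the source of all the homotopies inside a
cube through `Factors.homotopic`. -/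
instance {n : ℕ} : ContractibleSpace (Fin n → I) := by
  refine (contractible_iff_id_nullhomotopic _).2 ⟨fun _ => 0, ⟨?_⟩⟩
  exact
    { toFun := fun p => CubeCx.segment p.2 (fun _ => 0) p.1
      continuous_toFun := continuous_segment.comp (by fun_prop :
        Continuous fun p : I × (Fin n → I) => ((p.2, fun _ => 0, p.1) :
          (Fin n → I) × (Fin n → I) × I))
      map_zero_left := fun x => by simp
      map_one_left := fun x => by simp }

/-- Every point of a cube is an interior point of a face. -/
theorem exists_face_interior {m : ℕ} (s : Fin m → I) :
    ∃ (k : ℕ) (u : (Fin k → I) → (Fin m → I)) (s₀ : Fin k → I),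
      IsFaceMap u ∧ s₀ ∈ openCube k ∧ u s₀ = s := by
  classical
  let S : Finset (Fin m) := {j | s j ∈ Set.Ioo (0 : I) 1}
  have hS : ∀ j, j ∈ S ↔ s j ∈ Set.Ioo (0 : I) 1 := fun j => by simp [S]
  let e : Fin S.card ↪ Fin m := S.equivFin.symm.toEmbedding.trans (.subtype _)
  have he : ∀ j, j ∈ Set.range e ↔ j ∈ S := fun j => by
    constructor
    · rintro ⟨i, rfl⟩
      exact (S.equivFin.symm i).2
    · exact fun h => ⟨S.equivFin ⟨j, h⟩, by simp [e]⟩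
  refine ⟨S.card, fun x j => if h : j ∈ S then x (S.equivFin ⟨j, h⟩) else s j, fun i => s (e i),
    ⟨e, fun i => .inl fun x => ?_, fun j hj => ?_⟩, fun i => (hS _).1 ((he _).1 ⟨i, rfl⟩), ?_⟩
  · have h : e i ∈ S := (he _).1 ⟨i, rfl⟩
    simp only [h, dite_true]
    congr 1
    exact (Equiv.eq_symm_apply _).1 (Subtype.ext rfl)
  · have h : j ∉ S := fun h => hj ((he j).2 h)
    simp only [h, dite_false]
    rw [hS, Set.mem_Ioo, not_and_or, not_lt, not_lt, le_zero_iff] at h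
    exact h.imp (fun h _ => h) (fun h _ => le_antisymm unitInterval.le_one' h)
  · ext j
    by_cases h : j ∈ S <;> simp [h, e]

/-- The point `t` of `[0,1]ⁿ` is at distance at least `δ` from the boundary. -/
def Deep {n : ℕ} (δ : ℝ) (t : Fin n → I) : Prop :=
  δ ≤ 1 / 2 ∧ ∀ i, δ ≤ (t i : ℝ) ∧ (t i : ℝ) ≤ 1 - δ

theorem exists_deep {n : ℕ} {t : Fin n → I} (ht : t ∈ openCube n) : ∃ δ > 0, Deep δ t := by
  have h : ∀ᶠ δ : ℝ in nhdsWithin 0 (Set.Ioi 0), Deep δ t := by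
    refine Filter.Eventually.filter_mono nhdsWithin_le_nhds ?_
    refine (Filter.Eventually.and (eventually_le_nhds (by norm_num)) ?_)
    refine Filter.eventually_all.2 fun i => ?_
    obtain ⟨h0, h1⟩ := ht i
    have h0 : (0 : ℝ) < t i := h0
    have h1 : (t i : ℝ) < 1 := h1
    filter_upwards [eventually_le_nhds h0, eventually_le_nhds (sub_pos.2 h1)] with δ h h'
    exact ⟨h, by linarith⟩
  obtain ⟨δ, h, h'⟩ := (h.and self_mem_nhdsWithin).exists
  exact ⟨δ, h', h⟩

theorem Deep.openCube {n : ℕ} {δ : ℝ} (hδ : 0 < δ) {t : Fin n → I} (h : Deep δ t) :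
    t ∈ openCube n := fun i =>
  ⟨show (0 : ℝ) < t i by linarith [(h.2 i).1], show (t i : ℝ) < 1 by linarith [(h.2 i).2]⟩

/-- If a face `u` contains an interior point which is close to a point of a face `f` which is far
from the boundary of `f`, then `u` contains `f`. -/
theorem IsFaceMap.factor {k m n : ℕ} {u : (Fin k → I) → (Fin m → I)}
    {f : (Fin n → I) → (Fin m → I)} (hu : IsFaceMap u) (hf : IsFaceMap f) {s : Fin k → I}
    {t : Fin n → I} {δ : ℝ} (ht : Deep δ t) (h : dist (u s) (f t) < δ) :
    ∃ g : (Fin n → I) → (Fin k → I), IsFaceMap g ∧ f = u ∘ g := by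
  classical
  have hδ : 0 < δ := dist_nonneg.trans_lt h
  have hd : ∀ j, |(u s j : ℝ) - f t j| < δ := (dist_pi_lt_iff hδ).1 h
  obtain ⟨a, ha, hac⟩ := hu
  obtain ⟨b, hb, hbc⟩ := hf
  have hba : ∀ i, ∃ l, a l = b i := by
    intro i
    -- A coordinate along which `f` moves must move along `u` too: otherwise `u` is `0` or `1`
    -- there, while `f t` stays at distance at least `δ` from both.
    by_contra hi
    have h1 := abs_lt.1 (hd (b i))
    have h2 := ht.2 i
    rcases hac (b i) (fun ⟨l, hl⟩ => hi ⟨l, hl⟩) with h3 | h3 <;> rcases hb i with h4 | h4 <;>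
      simp only [h3, h4, unitInterval.coe_symm_eq, Set.Icc.coe_zero, Set.Icc.coe_one] at h1 <;>
      linarith
  choose e he using hba
  have he' : Function.Injective e := fun i j hij => b.injective (by rw [← he, ← he, hij])
  -- The factor reads the coordinates of `f` along the directions of `u`, undoing the reflection
  -- wherever `u` reflects.
  refine ⟨fun x l => if ∀ y, u y (a l) = y l then f x (a l) else σ (f x (a l)),
    ⟨⟨e, he'⟩, fun i => ?_, fun l hl => ?_⟩, ?_⟩
  · simp only [Function.Embedding.coeFn_mk, he]
    split_ifs <;> rcases hb i with h | h <;> simp [h]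
  · have hl' : a l ∉ Set.range b := by
      rintro ⟨i, hi⟩
      exact hl ⟨i, a.injective ((he i).trans hi)⟩
    beta_reduce
    split_ifs <;> rcases hbc _ hl' with h | h <;> simp [h]
  · funext x j
    by_cases hj : j ∈ Set.range a
    · obtain ⟨l, rfl⟩ := hj
      by_cases h : ∀ y, u y (a l) = y l
      · simp [h]
      · have h' := (ha l).resolve_left h
        rw [Function.comp_apply, h', if_neg h, unitInterval.symm_symm]
    · have hj' : j ∉ Set.range b := by
        rintro ⟨i, rfl⟩
        exact hj ⟨_, he i⟩
      -- In the directions fixed by both faces, distinct constants would differ by `1`; the bound `δ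
      -- ≤ 1 / 2` in `Deep` excludes this, also when `n = 0` and there is no coordinate to bound
      -- `δ`.
      have h1 := abs_lt.1 (hd j)
      have h2 := ht.1
      rcases hac j hj with h3 | h3 <;> rcases hbc j hj' with h4 | h4 <;>
        simp only [h3, h4, Set.Icc.coe_zero, Set.Icc.coe_one, Function.comp] at h1 ⊢ <;>
        linarith

theorem IsFaceMap.openCube {n : ℕ} {f : (Fin n → I) → (Fin n → I)} (hf : IsFaceMap f)
    {t : Fin n → I} (ht : t ∈ openCube n) : f t ∈ openCube n := by
  obtain ⟨e, he, -⟩ := hf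
  intro j
  obtain ⟨i, rfl⟩ := (Finite.injective_iff_surjective.1 e.injective) j
  rcases he i with h | h
  · rw [h]
    exact ht i
  · rw [h]
    exact ⟨unitInterval.pos_iff_ne_zero.2 fun h' => (ht i).2.ne (by simpa using h'),
      unitInterval.lt_one_iff_ne_one.2 fun h' => (ht i).1.ne' (by simpa using h')⟩

namespace CubeComplex

variable {X : Type u} [TopologicalSpace X] {K : CubeComplex X}

/-! ### Open stars -/

/-- Two cubes which contain a given point have a common face, which contains this point in its
interior. -/
theorem exists_common_face {m m' : ℕ} (d : K.Cube m) (d' : K.Cube m') {s : Fin m → I}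
    {s' : Fin m' → I} (h : d.1 s = d'.1 s') :
    ∃ (k : ℕ) (v : (Fin k → I) → (Fin m → I)) (v' : (Fin k → I) → (Fin m' → I)) (s₀ : Fin k → I),
      IsFaceMap v ∧ IsFaceMap v' ∧ s₀ ∈ openCube k ∧ v s₀ = s ∧ v' s₀ = s' ∧
        d.1 ∘ v = d'.1 ∘ v' := by
  obtain ⟨k, v, s₀, hv, hs₀, rfl⟩ := exists_face_interior s
  obtain ⟨k', v', s₁, hv', hs₁, rfl⟩ := exists_face_interior s'
  obtain ⟨g, hg, hgs, hgd⟩ := K.eq_of_meet _ _ (d.face v hv).2 (d'.face v' hv').2 s₀ hs₀ s₁ hs₁ h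
  exact ⟨k, v, v' ∘ g, s₀, hv, hv'.comp hg, hs₀, rfl, by simp [hgs], hgd⟩

/-- If the cube `c` is the face `f` of the cube `d`, and if a point of `d` close to `c t` belongs
to another cube `d'`, then `c` is also a face of `d'`, and the common face of `d` and `d'` spanned
by this point contains `c`. -/
theorem exists_common_face_of_dist_lt {n m m' : ℕ} {c : K.Cube n} {t : Fin n → I} {δ : ℝ}
    (ht : Deep δ t) (d : K.Cube m) (d' : K.Cube m') {f : (Fin n → I) → (Fin m → I)}
    (hf : IsFaceMap f) (hc : d.1 ∘ f = c.1) {s : Fin m → I} {s' : Fin m' → I}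
    (hs : dist s (f t) < δ) (h : d.1 s = d'.1 s') :
    ∃ (k : ℕ) (v : (Fin k → I) → (Fin m → I)) (v' : (Fin k → I) → (Fin m' → I))
      (f' : (Fin n → I) → (Fin m' → I)) (s₀ t₀ : Fin k → I),
      IsFaceMap v ∧ IsFaceMap v' ∧ IsFaceMap f' ∧ d.1 ∘ v = d'.1 ∘ v' ∧ d'.1 ∘ f' = c.1 ∧
        v s₀ = s ∧ v' s₀ = s' ∧ v t₀ = f t ∧ v' t₀ = f' t := by
  obtain ⟨k, v, v', s₀, hv, hv', -, rfl, rfl, hd⟩ := exists_common_face d d' h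
  obtain ⟨g, hg, rfl⟩ := hv.factor hf ht hs
  refine ⟨k, v, v', v' ∘ g, s₀, g t, hv, hv', hv'.comp hg, hd, ?_, rfl, rfl, rfl, rfl⟩
  rw [← hc, ← Function.comp_assoc, ← hd, Function.comp_assoc]

/-- If the cube `c` is a face of `d` in two ways, then the two lifts of a point of `c` are
far away. -/
theorem eq_of_dist_lt {n m : ℕ} {c : K.Cube n} {t : Fin n → I} {δ : ℝ} (ht : Deep δ t)
    (d : K.Cube m) {f f' : (Fin n → I) → (Fin m → I)} (hf : IsFaceMap f) (hf' : IsFaceMap f')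
    (hc : d.1 ∘ f = c.1) (hc' : d.1 ∘ f' = c.1) (h : dist (f' t) (f t) < δ) : f t = f' t := by
  have ho := ht.openCube (dist_nonneg.trans_lt h)
  obtain ⟨g, hg, rfl⟩ := hf'.factor hf ht h
  -- Here `g` is a symmetry of the cube with `c ∘ g = c`, so injectivity on the open cube forces `g
  -- t = t`.
  refine congrArg f' (K.injOn c.1 c.2 (hg.openCube ho) ho ?_)
  rw [← Function.comp_apply (f := c.1), ← hc', Function.comp_assoc, hc]
  exact congrFun hc'.symm t

variable (K)

/-- The open star of radius `δ` of the point `c t`. -/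
def star {n : ℕ} (c : K.Cube n) (t : Fin n → I) (δ : ℝ) : Set X :=
  {y | ∃ (m : ℕ) (d : K.Cube m) (f : (Fin n → I) → (Fin m → I)) (s : Fin m → I),
    IsFaceMap f ∧ d.1 ∘ f = c.1 ∧ dist s (f t) < δ ∧ d.1 s = y}

variable {K}

theorem mem_star_self {n : ℕ} (c : K.Cube n) (t : Fin n → I) {δ : ℝ} (hδ : 0 < δ) :
    c.1 t ∈ K.star c t δ :=
  ⟨n, c, _, t, IsFaceMap.id n, rfl, by simpa using hδ, rfl⟩

/-- Membership, defined through some cube containing the point, can be tested in any cube containing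
it: the common face spanned by the point contains `c`, and face maps preserve distances. The trace
of a star on each cube is therefore a union of balls, which gives openness in the weak topology. -/
theorem mem_star_iff {n : ℕ} {c : K.Cube n} {t : Fin n → I} {δ : ℝ} (ht : Deep δ t) {m : ℕ}
    (d : K.Cube m) (s : Fin m → I) : d.1 s ∈ K.star c t δ ↔
      ∃ f : (Fin n → I) → (Fin m → I), IsFaceMap f ∧ d.1 ∘ f = c.1 ∧ dist s (f t) < δ := by
  constructor
  · rintro ⟨m', d', f, s', hf, hc, hs, h⟩
    obtain ⟨k, v, v', f', s₀, t₀, hv, hv', hf', -, hc', rfl, rfl, h1, h2⟩ :=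
      exists_common_face_of_dist_lt ht d' d hf hc hs h
    refine ⟨f', hf', hc', ?_⟩
    rwa [← h2, hv'.dist_eq, ← hv.dist_eq, h1]
  · rintro ⟨f, hf, hc, hs⟩
    exact ⟨m, d, f, s, hf, hc, hs, rfl⟩

theorem isOpen_star {n : ℕ} {c : K.Cube n} {t : Fin n → I} {δ : ℝ} (ht : Deep δ t) :
    IsOpen (K.star c t δ) := by
  refine (K.isOpen_iff _).2 fun m d hd => ?_
  have : d ⁻¹' K.star c t δ = ⋃ f ∈ {f : (Fin n → I) → (Fin m → I) | IsFaceMap f ∧ d ∘ f = c.1},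
      Metric.ball (f t) δ := by
    ext s
    simpa [and_assoc] using mem_star_iff ht ⟨d, hd⟩ s
  rw [this]
  exact isOpen_biUnion fun _ _ => Metric.isOpen_ball

end CubeComplex
namespace CubeComplex

variable {X : Type u} [TopologicalSpace X] {K : CubeComplex X}

/-! ### Covering spaces of cube complexes -/

variable (K) in
/-- A `G`-valued cocycle on a cube complex: `hol c t` describes the monodromy along the segments
from `c.corner` to `c t` in the cube `c`. -/
structure Holonomy (G : Type v) [Group G] where
  /-- The monodromy in a cube. -/
  hol : ∀ {n : ℕ}, K.Cube n → (Fin n → I) → G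
  hol_face : ∀ {m n : ℕ} (c : K.Cube n) (f : (Fin m → I) → (Fin n → I)) (hf : IsFaceMap f)
    (t : Fin m → I), hol (c.face f hf) t = (hol c (f fun _ => 0))⁻¹ * hol c (f t)

namespace Holonomy

variable {G : Type v} [Group G] (H : K.Holonomy G)

theorem ratio_face {m n : ℕ} (c : K.Cube n) (f : (Fin m → I) → (Fin n → I)) (hf : IsFaceMap f)
    (s t : Fin m → I) : (H.hol (c.face f hf) s)⁻¹ * H.hol (c.face f hf) t =
      (H.hol c (f s))⁻¹ * H.hol c (f t) := by
  rw [H.hol_face, H.hol_face]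
  group

/-- The quotient of two values of `hol` is the monodromy between two points, and it only depends on
a face containing both; this allows a change of cube in the total space. -/
theorem ratio_eq {k m m' : ℕ} {d : K.Cube m} {d' : K.Cube m'} {v : (Fin k → I) → (Fin m → I)}
    {v' : (Fin k → I) → (Fin m' → I)} (hv : IsFaceMap v) (hv' : IsFaceMap v')
    (h : d.1 ∘ v = d'.1 ∘ v') (s t : Fin k → I) :
    (H.hol d (v s))⁻¹ * H.hol d (v t) = (H.hol d' (v' s))⁻¹ * H.hol d' (v' t) := by
  rw [← H.ratio_face d v hv, ← H.ratio_face d' v' hv',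
    show d.face v hv = d'.face v' hv' from Subtype.ext h]

/-- The total space of the covering of `X` defined by a cocycle. -/
@[nolint unusedArguments]
def Total (_ : K.Holonomy G) : Type (max u v) := X × G

/-- The point of the total space with given coordinates. -/
def point (x : X) (g : G) : H.Total := (x, g)

/-- The lift of a cube of `X` to the total space. -/
def lift {n : ℕ} (c : K.Cube n) (g : G) (t : Fin n → I) : H.Total := (c.1 t, g * H.hol c t)

/-- The covering map. -/
def proj (e : H.Total) : X := e.1

/-- This is not the product topology: `hol c` may jump inside a cube, and it is the lifted cubes,
rather than the slices `X × {g}`, that are declared continuous. -/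
instance : TopologicalSpace H.Total :=
  ⨆ (n : ℕ) (c : K.Cube n) (g : G), TopologicalSpace.coinduced (H.lift c g) inferInstance

instance : MulAction G H.Total where
  smul g e := (e.1, g * e.2)
  one_smul e := Prod.ext rfl (one_mul e.2)
  mul_smul a b e := Prod.ext rfl (mul_assoc a b e.2)

theorem smul_def (g : G) (e : H.Total) : g • e = (e.1, g * e.2) := rfl

theorem smul_lift {n : ℕ} (c : K.Cube n) (a g : G) (t : Fin n → I) :
    a • H.lift c g t = H.lift c (a * g) t :=
  Prod.ext rfl (mul_assoc a g _).symm

theorem isOpen_total_iff (U : Set H.Total) : IsOpen U ↔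
    ∀ (n : ℕ) (c : K.Cube n) (g : G), IsOpen (H.lift c g ⁻¹' U) := by
  refine isOpen_iSup_iff.trans (forall_congr' fun n => isOpen_iSup_iff.trans
    (forall_congr' fun c => isOpen_iSup_iff.trans (forall_congr' fun g => isOpen_coinduced)))

theorem continuous_lift {n : ℕ} (c : K.Cube n) (g : G) : Continuous (H.lift c g) :=
  continuous_def.2 fun U hU => (H.isOpen_total_iff U).1 hU n c g

theorem exists_lift_eq (e : H.Total) :
    ∃ (n : ℕ) (c : K.Cube n), ∃ t ∈ openCube n, ∃ g, H.lift c g t = e := by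
  obtain ⟨x, a⟩ := e
  obtain ⟨n, c, hc, t, ht, rfl⟩ := K.cover x
  exact ⟨n, ⟨c, hc⟩, t, ht, a * (H.hol ⟨c, hc⟩ t)⁻¹, Prod.ext rfl (by simp [lift])⟩

/-- The lift of an open star. -/
def sheet {n : ℕ} (c : K.Cube n) (t : Fin n → I) (δ : ℝ) (g : G) : Set H.Total :=
  {e | ∃ (m : ℕ) (d : K.Cube m) (f : (Fin n → I) → (Fin m → I)) (s : Fin m → I) (a : G),
    IsFaceMap f ∧ d.1 ∘ f = c.1 ∧ dist s (f t) < δ ∧ a * H.hol d (f t) = g ∧ H.lift d a s = e}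

/-- As for `mem_star_iff`, any cube through the point serves as a test. In addition the fiber
coordinate reached at the center of the star is the same in every such cube, by `ratio_eq`. -/
theorem lift_mem_sheet_iff {n : ℕ} {c : K.Cube n} {t : Fin n → I} {δ : ℝ} (ht : Deep δ t) (g : G)
    {m : ℕ} (d : K.Cube m) (a : G) (s : Fin m → I) : H.lift d a s ∈ H.sheet c t δ g ↔
      ∃ f : (Fin n → I) → (Fin m → I), IsFaceMap f ∧ d.1 ∘ f = c.1 ∧ dist s (f t) < δ ∧
        a * H.hol d (f t) = g := by
  constructor
  · rintro ⟨m', d', f, s', b, hf, hc, hs, rfl, h⟩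
    obtain ⟨h1, h2⟩ := Prod.ext_iff.1 h
    obtain ⟨k, v, v', f', s₀, t₀, hv, hv', hf', hd, hc', rfl, rfl, h3, h4⟩ :=
      exists_common_face_of_dist_lt ht d' d hf hc hs h1
    refine ⟨f', hf', hc', by rwa [← h4, hv'.dist_eq, ← hv.dist_eq, h3], ?_⟩
    have key := H.ratio_eq hv hv' hd s₀ t₀
    change b * H.hol d' (v s₀) = a * H.hol d (v' s₀) at h2
    rw [← h3, ← h4, eq_mul_inv_of_mul_eq h2, mul_assoc, mul_assoc, key]
    group
  · rintro ⟨f, hf, hc, hs, h⟩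
    exact ⟨m, d, f, s, a, hf, hc, hs, h, rfl⟩

theorem isOpen_sheet {n : ℕ} {c : K.Cube n} {t : Fin n → I} {δ : ℝ} (ht : Deep δ t) (g : G) :
    IsOpen (H.sheet c t δ g) := by
  refine (H.isOpen_total_iff _).2 fun m d a => ?_
  have : H.lift d a ⁻¹' H.sheet c t δ g = ⋃ f ∈ {f : (Fin n → I) → (Fin m → I) |
      IsFaceMap f ∧ d.1 ∘ f = c.1 ∧ a * H.hol d (f t) = g}, Metric.ball (f t) δ := by
    ext s
    rw [Set.mem_preimage, H.lift_mem_sheet_iff ht]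
    simp only [Set.mem_iUnion, Set.mem_ofPred_eq, Metric.mem_ball, exists_prop]
    exact exists_congr fun _ => by tauto
  rw [this]
  exact isOpen_biUnion fun _ _ => Metric.isOpen_ball

theorem isQuotientMap_proj : Topology.IsQuotientMap H.proj := by
  refine (Topology.isQuotientMap_iff _).2 ⟨Topology.isCoinducing_iff.2 fun U => ?_,
    fun x => ⟨H.point x 1, rfl⟩⟩
  rw [K.isOpen_iff, H.isOpen_total_iff]
  exact ⟨fun h n c hc => h n ⟨c, hc⟩ 1, fun h n c _ => h n c.1 c.2⟩

theorem continuous_smul (g : G) : Continuous fun e : H.Total => g • e := by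
  refine continuous_def.2 fun U hU => (H.isOpen_total_iff _).2 fun n c a => ?_
  have : H.lift c a ⁻¹' ((g • ·) ⁻¹' U) = H.lift c (g * a) ⁻¹' U := by
    ext t
    simp only [Set.mem_preimage, smul_lift]
  rw [this]
  exact (H.isOpen_total_iff U).1 hU n c _

theorem exists_disjoint_nhds (e : H.Total) :
    ∃ U ∈ nhds e, ∀ g : G, ((g • ·) '' U ∩ U).Nonempty → g = 1 := by
  obtain ⟨n, c, t, ht, g, rfl⟩ := H.exists_lift_eq e
  obtain ⟨δ, hδ, hd⟩ := exists_deep ht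
  -- The radius is halved so that two lifts of the center, both close to one point of the same cube,
  -- are at distance less than `δ` and coincide by `eq_of_dist_lt`; comparing fiber coordinates then
  -- gives `a = 1`.
  have hd' : Deep (δ / 2) t :=
    ⟨by linarith [hd.1], fun i => ⟨by linarith [(hd.2 i).1], by linarith [(hd.2 i).2]⟩⟩
  refine ⟨H.sheet c t (δ / 2) (g * H.hol c t), (H.isOpen_sheet hd' _).mem_nhds
    ((H.lift_mem_sheet_iff hd' _ _ _ _).2 ⟨_, IsFaceMap.id n, rfl, by simpa using hδ, rfl⟩), ?_⟩
  rintro a ⟨_, ⟨_, ⟨m, d, f, s, b, hf, hc, hs, hb, rfl⟩, rfl⟩, h⟩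
  simp only [smul_lift] at h
  obtain ⟨f', hf', hc', hs', hb'⟩ := (H.lift_mem_sheet_iff hd' _ _ _ _).1 h
  have : f t = f' t := eq_of_dist_lt hd d hf hf' hc hc' (by
    linarith [dist_triangle (f' t) s (f t), dist_comm s (f' t)])
  rw [← this, mul_assoc, hb] at hb'
  simpa using hb'

theorem isQuotientCoveringMap_proj : IsQuotientCoveringMap H.proj G where
  __ := H.isQuotientMap_proj
  continuous_const_smul := H.continuous_smul
  apply_eq_iff_mem_orbit {e e'} := by
    refine ⟨fun h => ⟨e.2 * e'.2⁻¹, Prod.ext h.symm (by simp [smul_def])⟩, ?_⟩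
    rintro ⟨g, rfl⟩
    rfl
  disjoint := H.exists_disjoint_nhds

/-- Lifts of homotopic paths with the same origin have the same endpoint. -/
theorem eq_of_homotopic {x y : X} {p q : Path x y} (h : p.Homotopic q) {e a b : H.Total}
    (P : Path e a) (Q : Path e b) (hP : ∀ t, H.proj (P t) = p t) (hQ : ∀ t, H.proj (Q t) = q t) :
    a = b := by
  have cov := H.isQuotientCoveringMap_proj.isCoveringMap
  have he : x = H.proj e := by simpa using (hP 0).symm
  have h1 := (cov.eq_liftPath_iff' (γ := p.toContinuousMap) (e := e)
    (show p 0 = _ by simpa using he) (Γ := P.toContinuousMap)).2 ⟨funext hP, P.source⟩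
  have h2 := (cov.eq_liftPath_iff' (γ := q.toContinuousMap) (e := e)
    (show q 0 = _ by simpa using he) (Γ := Q.toContinuousMap)).2 ⟨funext hQ, Q.source⟩
  have h3 := cov.liftPath_apply_one_eq_of_homotopicRel h e (show p 0 = _ by simpa using he)
    (show q 0 = _ by simpa using he)
  rw [← h1, ← h2] at h3
  exact P.target.symm.trans (h3.trans Q.target)

/-- The product of the monodromies of the edges of a path in the one-skeleton. -/
def edgeHol (γ : List K.Edge) : G := (γ.map fun e => H.hol e fun _ => 1).prod

theorem hol_zero {n : ℕ} (c : K.Cube n) : H.hol c (fun _ => 0) = 1 := by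
  have := H.hol_face c _ (IsFaceMap.id n) fun _ => 0
  rw [inv_mul_cancel] at this
  exact this

/-- Each edge lifts by `H.lift`, and its monodromy multiplies the fiber coordinate on the right;
this commutes with the deck action, which is on the left. -/
theorem exists_lift_path {x y : X} {γ : List K.Edge} (h : K.IsPath x γ y) (g : G) :
    ∃ P : Path (H.point x g) (H.point y (g * H.edgeHol γ)), ∀ t, H.proj (P t) = h.toPath t := by
  induction γ generalizing x g with
  | nil =>
    obtain rfl : x = y := h
    exact ⟨(Path.refl _).cast rfl (by simp [edgeHol]), fun t => rfl⟩
  | cons e γ ih =>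
    obtain ⟨rfl, h'⟩ := h
    obtain ⟨P, hP⟩ := ih h' (g * H.hol e fun _ => 1)
    let Q : Path (H.point e.src g) (H.point e.tgt (g * H.hol e fun _ => 1)) :=
      { toFun := fun t => H.lift e g fun _ => t
        continuous_toFun := (H.continuous_lift e g).comp (continuous_pi fun _ => continuous_id)
        source' := Prod.ext rfl (by simp [lift, point, hol_zero])
        target' := rfl }
    refine ⟨(Q.trans P).cast rfl (by simp [edgeHol, mul_assoc]), fun t => ?_⟩
    change H.proj ((Q.trans P) t) = ((e.toPath.cast rfl rfl).trans h'.toPath) t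
    rw [Path.trans_apply, Path.trans_apply]
    split_ifs
    · rfl
    · exact hP _

/-- Homotopic paths of the one-skeleton have the same monodromy. -/
theorem edgeHol_eq_of_homotopic {x y : X} {γ γ' : List K.Edge} (h : K.IsPath x γ y)
    (h' : K.IsPath x γ' y) (hh : h.toPath.Homotopic h'.toPath) : H.edgeHol γ = H.edgeHol γ' := by
  obtain ⟨P, hP⟩ := H.exists_lift_path h 1
  obtain ⟨Q, hQ⟩ := H.exists_lift_path h' 1
  simpa [point] using congrArg Prod.snd (H.eq_of_homotopic hh P Q hP hQ)

end Holonomy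
end CubeComplex

/-! ### Parallel edges in a cube -/

/-- The possible coordinates `0` and `1` of a vertex of a cube. -/
def bit (b : Bool) : I := if b then 1 else 0

/-- The vertex of a cube with the given coordinates. -/
def vert {n : ℕ} (ε : Fin n → Bool) : Fin n → I := fun j => bit (ε j)

theorem vert_update {n : ℕ} (ε : Fin n → Bool) (j : Fin n) (b : Bool) :
    vert (Function.update ε j b) = Function.update (vert ε) j (bit b) := by
  ext i
  by_cases h : i = j
  · subst h; simp [vert]
  · simp [vert, h]

theorem bit_eq (b : Bool) : bit b = 0 ∨ bit b = 1 := by cases b <;> simp [bit]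

/-- The edge of a cube in the `i`-th direction through a vertex. -/
def side {n : ℕ} (ε : Fin n → Bool) (i : Fin n) (x : Fin 1 → I) : Fin n → I :=
  Function.update (vert ε) i (x 0)

/-- The square of a cube in the directions `i` and `j` through a vertex. -/
def squareAt {n : ℕ} (ε : Fin n → Bool) (i j : Fin n) (x : Fin 2 → I) : Fin n → I :=
  Function.update (Function.update (vert ε) i (x 0)) j (x 1)

theorem isFaceMap_side {n : ℕ} (ε : Fin n → Bool) (i : Fin n) : IsFaceMap (side ε i) := by
  refine ⟨⟨fun _ => i, fun a b _ => Subsingleton.elim a b⟩, fun k => Or.inl fun x => ?_,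
    fun j hj => ?_⟩
  · change side ε i x i = x k
    simp [side, Subsingleton.elim k 0]
  · have h : j ≠ i := fun h => hj ⟨0, h.symm⟩
    simpa [side, h, vert] using bit_eq (ε j)

theorem isFaceMap_squareAt {n : ℕ} (ε : Fin n → Bool) {i j : Fin n} (hij : i ≠ j) :
    IsFaceMap (squareAt ε i j) := by
  refine ⟨⟨![i, j], ?_⟩, fun k => Or.inl fun x => ?_, fun l hl => ?_⟩
  · intro a b h
    fin_cases a <;> fin_cases b <;> simp_all
  · change squareAt ε i j x (![i, j] k) = x k
    fin_cases k <;> simp [squareAt, hij]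
  · have h : l ≠ i := fun h => hl ⟨0, h.symm⟩
    have h' : l ≠ j := fun h => hl ⟨1, h.symm⟩
    simpa [squareAt, h, h', vert] using bit_eq (ε l)

theorem squareAt_comp_axis_zero {n : ℕ} (ε : Fin n → Bool) {i j : Fin n} (hij : i ≠ j) :
    squareAt ε i j ∘ axis 0 = side (Function.update ε j false) i := by
  funext x
  simp [squareAt, side, axis, vert_update, bit, Function.update_comm hij]

theorem squareAt_comp_axis_one {n : ℕ} (ε : Fin n → Bool) {i j : Fin n} :
    squareAt ε i j ∘ axis 1 = side (Function.update ε i false) j := by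
  funext x
  simp [squareAt, side, axis, vert_update, bit]

theorem squareAt_comp_top {n : ℕ} (ε : Fin n → Bool) {i j : Fin n} (hij : i ≠ j) :
    squareAt ε i j ∘ top = side (Function.update ε j true) i := by
  funext x
  simp [squareAt, side, top, vert_update, bit, Function.update_comm hij]

/-- A function of Boolean vectors which does not depend on any coordinate is constant. -/
theorem eq_of_update_eq {ι Q : Type*} [Fintype ι] [DecidableEq ι] {F : (ι → Bool) → Q}
    (h : ∀ ε j b, F (Function.update ε j b) = F ε) (ε ε' : ι → Bool) : F ε = F ε' := by
  have : ∀ S : Finset ι, F (S.piecewise ε' ε) = F ε := fun S => by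
    induction S using Finset.induction_on with
    | empty => simp
    | insert j S _ ih => rw [Finset.piecewise_insert, h, ih]
  rw [← this Finset.univ, Finset.piecewise_univ]

namespace CubeComplex

variable {X : Type u} [TopologicalSpace X] {K : CubeComplex X}

/-- Changing a coordinate of the vertex other than the `i`-th slides the edge across a square of the
cube, and the `i`-th coordinate plays no role. -/
theorem orientedHyperplane_side {n : ℕ} (c : K.Cube n) (ε : Fin n → Bool) (i : Fin n) :
    (c.face (side ε i) (isFaceMap_side ε i)).orientedHyperplane =
      (c.edge i).orientedHyperplane := by
  have h0 : c.edge i =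
      c.face (side (fun _ => false) i) (isFaceMap_side (fun _ => false) i) := rfl
  rw [h0]
  refine eq_of_update_eq (F := fun ε =>
    (c.face (side ε i) (isFaceMap_side ε i)).orientedHyperplane) (fun ε j b => ?_) _ _
  by_cases hij : i = j
  · subst hij
    refine congrArg Cube.orientedHyperplane (Subtype.ext ?_)
    change c.1 ∘ side _ i = c.1 ∘ side _ i
    congr 1
    funext x
    simp [side, vert_update]
  · have key : (c.face (side (Function.update ε j false) i)
          (isFaceMap_side _ i)).orientedHyperplane =
        (c.face (side (Function.update ε j true) i) (isFaceMap_side _ i)).orientedHyperplane := by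
      refine Quot.sound ⟨c.face _ (isFaceMap_squareAt ε hij), Subtype.ext ?_, Subtype.ext ?_⟩
      · exact (Function.comp_assoc _ _ _).trans (congrArg _ (squareAt_comp_axis_zero ε hij))
      · exact (Function.comp_assoc _ _ _).trans (congrArg _ (squareAt_comp_top ε hij))
    have h : ε = Function.update ε j (ε j) := (Function.update_eq_self j ε).symm
    conv_rhs => rw [h]
    cases b <;> cases ε j <;> simp only [key]

theorem transverse_edge {n : ℕ} (c : K.Cube n) {i j : Fin n} (hij : i ≠ j) :
    K.Transverse (c.edge i).hyperplane (c.edge j).hyperplane := by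
  have h := squareAt_comp_axis_one (fun _ => false) (i := i) (j := j)
  have h' := squareAt_comp_axis_zero (fun _ => false) hij
  rw [Function.update_eq_self_iff.2 rfl] at h h'
  exact ⟨c.face _ (isFaceMap_squareAt (fun _ => false) hij),
    congrArg Cube.hyperplane (Subtype.ext ((Function.comp_assoc _ _ _).trans (congrArg _ h'))),
    congrArg Cube.hyperplane (Subtype.ext ((Function.comp_assoc _ _ _).trans (congrArg _ h)))⟩

/-- The `k`-th edge of a face is the side of the ambient cube in the direction `e k` through the
vertex `f 0`, reversed exactly when `f` reflects this direction; `orientedHyperplane_side` then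
moves it to the corner. -/
theorem orientedHyperplane_edge_face {m n : ℕ} (c : K.Cube n) {f : (Fin m → I) → (Fin n → I)}
    (hf : IsFaceMap f) (e : Fin m ↪ Fin n)
    (he : ∀ i, (∀ x, f x (e i) = x i) ∨ (∀ x, f x (e i) = σ (x i)))
    (hc : ∀ j, j ∉ Set.range e → (∀ x, f x j = 0) ∨ (∀ x, f x j = 1)) (k : Fin m) :
    ((∀ x, f x (e k) = x k) → ((c.face f hf).edge k).orientedHyperplane =
      (c.edge (e k)).orientedHyperplane) ∧
    ((∀ x, f x (e k) = σ (x k)) → ((c.face f hf).edge k).orientedHyperplane =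
      (c.edge (e k)).orientedHyperplane.inv) := by
  classical
  let ε : Fin n → Bool := fun j => decide (f (fun _ => 0) j = 1)
  have hε : ∀ x j, j ≠ e k → f (axis k x) j = bit (ε j) := by
    intro x j hj
    by_cases hj' : j ∈ Set.range e
    · obtain ⟨l, rfl⟩ := hj'
      have hl : l ≠ k := fun h => hj (congrArg e h)
      rcases he l with h | h <;> simp [ε, h, axis, hl, bit]
    · rcases hc j hj' with h | h <;> simp [ε, h, bit]
  constructor
  · intro h
    rw [← orientedHyperplane_side c ε]
    refine congrArg Cube.orientedHyperplane (Subtype.ext ((Function.comp_assoc _ _ _).trans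
      (congrArg (c.1 ∘ ·) (funext fun x => funext fun j => ?_))))
    by_cases hj : j = e k
    · subst hj
      simp [h, axis, side]
    · simp [hε x j hj, side, hj, vert]
  · intro h
    rw [← orientedHyperplane_side c ε]
    refine congrArg Cube.orientedHyperplane (Subtype.ext ((Function.comp_assoc _ _ _).trans
      (congrArg (c.1 ∘ ·) (funext fun x => funext fun j => ?_))))
    by_cases hj : j = e k
    · subst hj
      simp [h, axis, side, rev]
    · simp [hε x j hj, side, hj, vert, rev]

/-! ### The cocycle defined by a coloring -/

namespace SpecialColoring

variable {V : Type v} {Δ : SimpleGraph V} (φ : K.SpecialColoring Δ)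

/-- Whether the point `t` of an edge has been reached by the endpoint of this edge: for an edge
with a positive color, when `t = 1`, and for an edge with a negative color, when `t ≠ 0`. -/
noncomputable def crossing (b : Bool) (t : I) : ℤ :=
  open Classical in if b then (if t = 1 then 1 else 0) else (if t = 0 then 0 else 1)

theorem crossing_zero (b : Bool) : crossing b 0 = 0 := by cases b <;> simp [crossing]

theorem crossing_one (b : Bool) : crossing b 1 = 1 := by cases b <;> simp [crossing]

/-- This identity dictates the asymmetric definition of `crossing`. Reversing an edge inverts its
color, so the jump has to be seen at the same geometric end from both directions; the sign of the
color selects this end. -/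
theorem crossing_not (b : Bool) (t : I) : crossing (!b) t = 1 - crossing b (σ t) := by
  cases b <;> simp only [crossing, Bool.not_true, Bool.not_false, unitInterval.symm_eq_one,
    unitInterval.symm_eq_zero, if_true, Bool.false_eq_true, if_false] <;> split_ifs <;> rfl

theorem adj_color_edge {n : ℕ} (c : K.Cube n) {i j : Fin n} (hij : i ≠ j) :
    Δ.Adj (φ.color (c.edge i)).1 (φ.color (c.edge j)).1 :=
  φ.adj_of_transverse _ _ (transverse_edge c hij)

theorem commute_zpowersHom_edge {n : ℕ} (c : K.Cube n) : Pairwise fun i j =>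
    ∀ x y : Multiplicative ℤ, Commute (zpowersHom _ ((φ.color (c.edge i)).toRAAG Δ) x)
      (zpowersHom _ ((φ.color (c.edge j)).toRAAG Δ) y) :=
  fun _ _ hij _ _ => (commute_toRAAG (φ.adj_color_edge c hij)).zpow_zpow _ _

/-- The morphism from `ℤⁿ` to `A(Δ)` defined by the colors of the edges of a cube at its corner. -/
noncomputable def axisHom {n : ℕ} (c : K.Cube n) : (Fin n → Multiplicative ℤ) →* RAAG Δ :=
  MonoidHom.noncommPiCoprod (fun i => zpowersHom _ ((φ.color (c.edge i)).toRAAG Δ))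
    (φ.commute_zpowersHom_edge c)

theorem axisHom_mulSingle {n : ℕ} (c : K.Cube n) (i : Fin n) (z : Multiplicative ℤ) :
    φ.axisHom c (Pi.mulSingle i z) = (φ.color (c.edge i)).toRAAG Δ ^ z.toAdd :=
  MonoidHom.noncommPiCoprod_mulSingle (N := fun _ : Fin n => Multiplicative ℤ)
    (fun i => zpowersHom _ ((φ.color (c.edge i)).toRAAG Δ)) (hcomm := φ.commute_zpowersHom_edge c) i z

/-- The numbers of edges crossed by a segment starting from the corner of a cube. -/
noncomputable def crossings {n : ℕ} (c : K.Cube n) (t : Fin n → I) : Fin n → Multiplicative ℤ :=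
  fun i => .ofAdd (crossing (φ.color (c.edge i)).2 (t i))

theorem color_edge_face {m n : ℕ} (c : K.Cube n) {f : (Fin m → I) → (Fin n → I)}
    (hf : IsFaceMap f) (e : Fin m ↪ Fin n)
    (he : ∀ i, (∀ x, f x (e i) = x i) ∨ (∀ x, f x (e i) = σ (x i)))
    (hc : ∀ j, j ∉ Set.range e → (∀ x, f x j = 0) ∨ (∀ x, f x j = 1)) (k : Fin m) :
    ((∀ x, f x (e k) = x k) → φ.color ((c.face f hf).edge k) = φ.color (c.edge (e k))) ∧
    ((∀ x, f x (e k) = σ (x k)) →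
      φ.color ((c.face f hf).edge k) = (φ.color (c.edge (e k))).inv) := by
  obtain ⟨h, h'⟩ := orientedHyperplane_edge_face c hf e he hc k
  exact ⟨fun hk => congrArg φ.φ (h hk), fun hk => (congrArg φ.φ (h' hk)).trans (φ.map_inv _)⟩

/-- Edge colors of a cube commute pairwise, so the right-hand side is the image under one morphism
of a vector of differences of crossings. Directions fixed by the face contribute nothing, and each
remaining one gives the corresponding factor for the face. -/
theorem axisHom_crossings_face {m n : ℕ} (c : K.Cube n) (f : (Fin m → I) → (Fin n → I))
    (hf : IsFaceMap f) (t : Fin m → I) :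
    φ.axisHom (c.face f hf) (φ.crossings (c.face f hf) t) =
      (φ.axisHom c (φ.crossings c (f fun _ => 0)))⁻¹ * φ.axisHom c (φ.crossings c (f t)) := by
  classical
  obtain ⟨e, he, hc⟩ := id hf
  rw [← _root_.map_inv, ← map_mul]
  set D := (φ.crossings c (f fun _ => 0))⁻¹ * φ.crossings c (f t)
  have hcomm : ((Finset.univ : Finset (Fin m)) : Set (Fin m)).Pairwise
      (Function.onFun Commute fun k => Pi.mulSingle (M := fun _ => Multiplicative ℤ) (e k) (D (e k))) :=
    fun _ _ _ _ _ => Commute.all _ _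
  -- The vector `D` is supported on the directions of the face.
  have key : D = Finset.univ.noncommProd (fun k => Pi.mulSingle (e k) (D (e k))) hcomm := by
    refine Eq.trans ?_ (Finset.noncommProd_eq_prod _ _).symm
    ext j
    rw [Finset.prod_apply]
    by_cases hj : j ∈ Set.range e
    · obtain ⟨k, rfl⟩ := hj
      rw [Finset.prod_eq_single k]
      · simp
      · intro l _ hl
        exact Pi.mulSingle_eq_of_ne (fun h => hl (e.injective h.symm)) _
      · simp
    · rw [Finset.prod_eq_one fun k _ => Pi.mulSingle_eq_of_ne (fun h => hj ⟨k, h.symm⟩) _]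
      rcases hc j hj with h | h <;> simp [D, crossings, h]
  rw [key, Finset.map_noncommProd]
  have hcomm' : ((Finset.univ : Finset (Fin m)) : Set (Fin m)).Pairwise (Function.onFun Commute
      fun k => zpowersHom _ ((φ.color ((c.face f hf).edge k)).toRAAG Δ)
        (φ.crossings (c.face f hf) t k)) :=
    fun _ _ _ _ h => φ.commute_zpowersHom_edge _ h _ _
  refine (show _ = Finset.univ.noncommProd _ hcomm' from rfl).trans
    (Finset.noncommProd_congr rfl (fun k _ => ?_) hcomm')
  rw [axisHom_mulSingle]
  obtain ⟨h1, h2⟩ := φ.color_edge_face c hf e he hc k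
  have hDk : D (e k) = .ofAdd (crossing (φ.color (c.edge (e k))).2 (f t (e k)) -
      crossing (φ.color (c.edge (e k))).2 (f (fun _ => 0) (e k))) := by
    rw [sub_eq_neg_add]
    rfl
  rw [hDk]
  simp only [zpowersHom_apply, toAdd_ofAdd, crossings]
  -- For a reflected direction, both the color and the crossing number change, and `crossing_not`
  -- matches the two changes.
  rcases he k with h | h
  · rw [h1 h, h, h, crossing_zero, sub_zero]
  · rw [h2 h, h, h, toRAAG_inv, unitInterval.symm_zero, crossing_one, inv_zpow', neg_eq_iff_eq_neg.2]
    simp [Color.inv, crossing_not]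

/-- The cocycle defined by a coloring. -/
noncomputable def holonomy : K.Holonomy (RAAG Δ) where
  hol c t := φ.axisHom c (φ.crossings c t)
  hol_face := φ.axisHom_crossings_face

theorem holonomy_edge (e : K.Edge) : φ.holonomy.hol e (fun _ => 1) = (φ.color e).toRAAG Δ := by
  have h : e.edge 0 = e := Subtype.ext (congrArg (e.1 ∘ ·) (funext fun x => funext fun i => by
    simp [axis, Subsingleton.elim i 0]))
  have h' : φ.crossings e (fun _ => 1) = Pi.mulSingle 0 (.ofAdd 1) := by
    ext i
    obtain rfl := Subsingleton.elim i 0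
    simp [crossings, crossing_one]
  change φ.axisHom e (φ.crossings e fun _ => 1) = _
  rw [h', axisHom_mulSingle, h]
  simp

/-- Homotopic paths of the one-skeleton represent the same element of `A(Δ)`. -/
theorem wordToRAAG_eq_of_homotopic {x y : X} {γ γ' : List K.Edge} (h : K.IsPath x γ y)
    (h' : K.IsPath x γ' y) (hh : h.toPath.Homotopic h'.toPath) :
    wordToRAAG Δ (γ.map φ.color) = wordToRAAG Δ (γ'.map φ.color) := by
  simpa [Holonomy.edgeHol, holonomy_edge, wordToRAAG, Function.comp_def] using
    φ.holonomy.edgeHol_eq_of_homotopic h h' hh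

end SpecialColoring
end CubeComplex
namespace CubeComplex
namespace SpecialColoring

/-! ### The word problem in right-angled Artin groups -/

section Words

variable {V : Type v} {Δ : SimpleGraph V}

/-- The elementary transformations of words which do not increase the length. -/
inductive Reduction (Δ : SimpleGraph V) : List (Color V) → List (Color V) → Prop
  | cancellation (c : Color V) (w : List (Color V)) : Reduction Δ (c :: c.inv :: w) w
  | commutation (c d : Color V) (w : List (Color V)) (h : Δ.Adj c.1 d.1) :
      Reduction Δ (c :: d :: w) (d :: c :: w)
  | cons (c : Color V) {w w' : List (Color V)} (h : Reduction Δ w w') :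
      Reduction Δ (c :: w) (c :: w')

variable (Δ) in
/-- A word is obtained from another one by cancellations and commutations. -/
abbrev Reduces : List (Color V) → List (Color V) → Prop := Relation.ReflTransGen (Reduction Δ)

theorem Reduces.cons {w w' : List (Color V)} (h : Reduces Δ w w') (c : Color V) :
    Reduces Δ (c :: w) (c :: w') := by
  induction h with
  | refl => exact .refl
  | tail _ h ih => exact ih.tail (.cons c h)

theorem Reduction.append_left {w w' : List (Color V)} (h : Reduction Δ w w')
    (u : List (Color V)) : Reduction Δ (u ++ w) (u ++ w') := by
  induction u with
  | nil => exact h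
  | cons c u ih => exact .cons c ih

theorem Reduction.move {w w' : List (Color V)} (h : Reduction Δ w w') : Move Δ w w' := by
  induction h with
  | cancellation c w => exact .cancellation [] w c
  | commutation c d w h => exact .commutation [] w c d h
  | cons c _ ih => exact Move.append_left ih [c]

/-- The second word is obtained from the first one by deleting a letter `c⁻¹` which is preceded
only by letters commuting with it. -/
inductive DeleteInv (Δ : SimpleGraph V) (c : Color V) : List (Color V) → List (Color V) → Prop
  | head (w : List (Color V)) : DeleteInv Δ c (c.inv :: w) w
  | cons {d : Color V} {w w' : List (Color V)} (h : Δ.Adj c.1 d.1) (hw : DeleteInv Δ c w w') :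
      DeleteInv Δ c (d :: w) (d :: w')

/-- The second word is obtained from the first one by deleting a letter `c` and a letter `c⁻¹`
which are separated only by letters commuting with them. -/
inductive DeletePair (Δ : SimpleGraph V) : List (Color V) → List (Color V) → Prop
  | head {c : Color V} {w w' : List (Color V)} (h : DeleteInv Δ c w w') :
      DeletePair Δ (c :: w) w'
  | cons (d : Color V) {w w' : List (Color V)} (h : DeletePair Δ w w') :
      DeletePair Δ (d :: w) (d :: w')

theorem DeleteInv.reduces {c : Color V} {w w' : List (Color V)} (h : DeleteInv Δ c w w') :
    Reduces Δ (c.inv :: w') w := by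
  induction h with
  | head w => exact .refl
  | cons h _ ih => exact .head (.commutation _ _ _ h) (ih.cons _)

/-- The marked letter `c⁻¹` is followed through one reduction step. Either it survives, and the
deletion can be performed afterwards, or it is cancelled against a neighboring `c`; in this case
that `c` remains once the mark is deleted, and it commutes back to the front. -/
theorem DeleteInv.reduction {c : Color V} {w w' w₁ : List (Color V)} (hr : Reduction Δ w w₁)
    (h : DeleteInv Δ c w w') :
    (∃ w₁', DeleteInv Δ c w₁ w₁' ∧ Reduces Δ w' w₁') ∨ Reduces Δ w' (c :: w₁) := by
  induction hr generalizing w' with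
  | cancellation d w =>
    cases h with
    | head => exact .inr (by rw [inv_inv])
    | cons hd h =>
      generalize hx : d.inv = x at h
      cases h with
      | head =>
        have : d.inv.1 = c.inv.1 := congrArg Prod.fst hx
        exact (hd.ne this.symm).elim
      | cons hd' h =>
        subst hx
        exact .inl ⟨_, h, .single (.cancellation d _)⟩
  | commutation a b w hab =>
    cases h with
    | head => exact .inl ⟨_, .cons hab (.head _), .refl⟩
    | cons ha h =>
      cases h with
      | head => exact .inl ⟨_, .head _, .refl⟩
      | cons hb h => exact .inl ⟨_, .cons hb (.cons ha h), .single (.commutation _ _ _ hab)⟩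
  | cons d hr ih =>
    cases h with
    | head => exact .inl ⟨_, .head _, .single hr⟩
    | cons hd h =>
      rcases ih h with ⟨w₁', h1, h2⟩ | h1
      · exact .inl ⟨_, .cons hd h1, h2.cons d⟩
      · exact .inr ((h1.cons d).tail (.commutation _ _ _ hd.symm))

/-- A diamond property: deleting a marked pair is compatible with a reduction step, unless the step
consumes a letter of the pair, in which case the shorter word reduces directly to the result of the
step. -/
theorem DeletePair.reduction {w w' w₁ : List (Color V)} (hr : Reduction Δ w w₁)
    (h : DeletePair Δ w w') :
    (∃ w₁', DeletePair Δ w₁ w₁' ∧ Reduces Δ w' w₁') ∨ Reduces Δ w' w₁ := by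
  induction hr generalizing w' with
  | cancellation d w =>
    cases h with
    | head h =>
      generalize hx : d.inv = x at h
      cases h with
      | head => exact .inr .refl
      -- The letter `d⁻¹` would have to be adjacent to `d`, and `Δ` has no loops.
      | cons hd h =>
        subst hx
        exact (hd.ne rfl).elim
    | cons _ h =>
      cases h with
      | head h =>
        -- The step cancels `d d⁻¹` while the marked pair is this `d⁻¹` and a later `d`: what
        -- survives is the first `d` instead of the later one, and commutations carry it to the
        -- place of the latter.
        right
        have := h.reduces
        rwa [inv_inv] at this
      | cons _ h => exact .inl ⟨_, h, .single (.cancellation d _)⟩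
  | commutation a b w hab =>
    cases h with
    | head h =>
      cases h with
      | head => exact (hab.ne rfl).elim
      | cons hb h => exact .inl ⟨_, .cons _ (.head h), .refl⟩
    | cons _ h =>
      cases h with
      | head h => exact .inl ⟨_, .head (.cons hab.symm h), .refl⟩
      | cons _ h => exact .inl ⟨_, .cons _ (.cons _ h), .single (.commutation _ _ _ hab)⟩
  | cons d hr ih =>
    cases h with
    | head h =>
      rcases h.reduction hr with ⟨w₁', h1, h2⟩ | h1
      · exact .inl ⟨_, .head h1, h2⟩
      · exact .inr h1
    | cons _ h =>
      rcases ih h with ⟨w₁', h1, h2⟩ | h1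
      · exact .inl ⟨_, .cons d h1, h2.cons d⟩
      · exact .inr (h1.cons d)

theorem DeletePair.reduces_nil {w w' : List (Color V)} (hr : Reduces Δ w [])
    (h : DeletePair Δ w w') : Reduces Δ w' [] := by
  induction hr using Relation.ReflTransGen.head_induction_on generalizing w' with
  | refl => cases h
  | head hr hr' ih =>
    rcases h.reduction hr with ⟨w₁', h1, h2⟩ | h1
    · exact h2.trans (ih h1)
    · exact h1.trans hr'

theorem deletePair_append (u w : List (Color V)) (c : Color V) :
    DeletePair Δ (u ++ c :: c.inv :: w) (u ++ w) := by
  induction u with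
  | nil => exact .head (.head w)
  | cons d u ih => exact .cons d ih

/-- Insertions are the only moves at issue, and `DeletePair.reduces_nil` says that undoing one keeps
the word reducible to the empty word. Hence insertions are never needed to trivialize a word. -/
theorem Move.reduces_nil_iff {w w' : List (Color V)} (h : Move Δ w w') :
    Reduces Δ w [] ↔ Reduces Δ w' [] := by
  have key : ∀ (u w : List (Color V)) (c : Color V),
      Reduces Δ (u ++ c :: c.inv :: w) [] ↔ Reduces Δ (u ++ w) [] := fun u w c =>
    ⟨fun h => (deletePair_append u w c).reduces_nil h,
      fun h => .head (Reduction.append_left (.cancellation c w) u) h⟩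
  cases h with
  | cancellation u w c => exact key u w c
  | insertion u w c => exact (key u w c).symm
  | commutation u w c d h =>
    exact ⟨fun h' => .head (Reduction.append_left (.commutation d c w h.symm) u) h',
      fun h' => .head (Reduction.append_left (.commutation c d w h) u) h'⟩

/-- Left multiplication by a letter on words up to elementary transformations. -/
def consPerm (Δ : SimpleGraph V) (c : Color V) : Equiv.Perm (Quot (Move Δ)) where
  toFun := Quot.map (c :: ·) fun _ _ h => Move.append_left h [c]
  invFun := Quot.map (c.inv :: ·) fun _ _ h => Move.append_left h [c.inv]
  left_inv := by
    rintro ⟨w⟩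
    have := Move.cancellation (Δ := Δ) [] w c.inv
    rw [inv_inv] at this
    exact Quot.sound this
  right_inv := by
    rintro ⟨w⟩
    exact Quot.sound (Move.cancellation (Δ := Δ) [] w c)

/-- The action of `A(Δ)` on words up to elementary transformations. -/
def wordAction (Δ : SimpleGraph V) : RAAG Δ →* Equiv.Perm (Quot (Move Δ)) :=
  PresentedGroup.toGroup (f := fun a => consPerm Δ (a, true)) (by
    rintro r ⟨a, b, h, rfl⟩
    simp only [map_mul, _root_.map_inv, FreeGroup.lift_apply_of]
    rw [mul_inv_eq_one, mul_inv_eq_iff_eq_mul]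
    refine Equiv.ext ?_
    rintro ⟨w⟩
    exact Quot.sound (Move.commutation [] w (a, true) (b, true) h))

theorem wordAction_toRAAG (c : Color V) : wordAction Δ (c.toRAAG Δ) = consPerm Δ c := by
  have h : ∀ a, wordAction Δ (PresentedGroup.of a) = consPerm Δ (a, true) := fun a =>
    PresentedGroup.toGroup.of _
  obtain ⟨a, _ | _⟩ := c
  · simp only [Color.toRAAG, Bool.false_eq_true, if_false, _root_.map_inv, h]
    rfl
  · simp only [Color.toRAAG, if_true, h]

/-- Acting on the empty word recovers the class of a word from its value in `A(Δ)`, so words with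
the same value differ by moves; the normal closure of the relators need not be analyzed. -/
theorem wordAction_wordToRAAG (w : List (Color V)) :
    wordAction Δ (wordToRAAG Δ w) (Quot.mk _ []) = Quot.mk _ w := by
  induction w with
  | nil => simp [wordToRAAG]
  | cons c w ih =>
    have : wordToRAAG Δ (c :: w) = c.toRAAG Δ * wordToRAAG Δ w := by simp [wordToRAAG]
    rw [this, map_mul, Equiv.Perm.mul_apply, ih, wordAction_toRAAG]
    rfl

/-- A word representing the trivial element of `A(Δ)` can be reduced to the empty word by
cancellations and commutations. -/
theorem reduces_nil_of_wordToRAAG_eq_one {w : List (Color V)} (h : wordToRAAG Δ w = 1) :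
    Reduces Δ w [] := by
  have h1 := wordAction_wordToRAAG (Δ := Δ) w
  rw [h, map_one, Equiv.Perm.one_apply] at h1
  -- Reducibility to the empty word descends to a predicate on words modulo moves.
  have h2 := congrArg (Quot.lift (fun w => Reduces Δ w [])
    fun _ _ h => propext (Move.reduces_nil_iff h)) h1
  exact cast h2 (.refl : Reduces Δ [] [])

end Words

/-! ### Injectivity of the canonical morphism -/

variable {X : Type u} [TopologicalSpace X] {K : CubeComplex X} {V : Type v} {Δ : SimpleGraph V}
  (φ : K.SpecialColoring Δ)

/-- The geometric content of the coloring axioms. Insertions have no such property, since an edge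
with the inserted color may not exist; this is why the word problem must be solved without them. -/
theorem Reduction.isLegal {w w' : List (Color V)} (h : Reduction Δ w w') {x y : X}
    (hw : φ.IsLegal x w y) : φ.IsLegal x w' y := by
  induction h generalizing x with
  | cancellation c w =>
    obtain ⟨z, h, h'⟩ := (φ.isLegal_append (u := [c, c.inv])).1 hw
    obtain rfl := φ.isLegal_pair h
    exact h'
  | commutation c d w hcd =>
    obtain ⟨e, rfl, rfl, hw'⟩ := (φ.isLegal_cons).1 hw
    obtain ⟨f, hf, rfl, hfw⟩ := (φ.isLegal_cons).1 hw'
    -- The square is taken at the middle vertex of the path `e`, `f`, whence `e.inv`. The other way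
    -- around it follows `(q.face diag _).opp` and then `q.opp.inv`, parallel to `f` and `e`
    -- respectively.
    obtain ⟨q, hq, rfl⟩ := φ.spanSquare_of_adj e.inv f ((src_inv e).trans hf.symm) (by
      change Δ.Adj (φ.color e.inv).1 (φ.color f).1
      rw [φ.color_inv]
      exact hcd)
    obtain rfl : (q.edge 0).inv = e := by
      rw [hq]
      exact Subtype.ext (funext fun t => congrArg e.1 (funext fun i => by simp [rev]))
    have h1 : K.Parallel (q.edge 1) (q.face diag isFaceMap_diag).opp := by
      refine ⟨q.face diag isFaceMap_diag, ?_, rfl⟩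
      refine Subtype.ext (funext fun x => congrArg q.1 (funext fun j => ?_))
      fin_cases j <;> simp [diag, axis]
    have h2 : K.Parallel (q.edge 0).inv q.opp.inv := Parallel.inv ⟨q, rfl, rfl⟩
    refine (φ.isLegal_cons).2 ⟨(q.face diag isFaceMap_diag).opp, ?_,
      (congrArg φ.φ (Quot.sound h1)).symm, (φ.isLegal_cons).2 ⟨q.opp.inv, ?_,
        (congrArg φ.φ (Quot.sound h2)).symm, ?_⟩⟩
    · refine congrArg q.1 (funext fun j => ?_)
      fin_cases j <;> simp [diag, axis, top, rev]
    · refine congrArg q.1 (funext fun j => ?_)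
      fin_cases j <;> simp [diag, top, rev]
    · convert hfw using 1
      refine congrArg q.1 (funext fun j => ?_)
      fin_cases j <;> simp [axis, top, rev]
  | cons c h ih =>
    obtain ⟨e, he, hc, hw⟩ := (φ.isLegal_cons).1 hw
    exact (φ.isLegal_cons).2 ⟨e, he, hc, ih hw⟩

theorem Reduces.equivalent {w w' : List (Color V)} (h : Reduces Δ w w') {x y : X}
    (hw : φ.IsLegal x w y) : φ.Equivalent x w w' := by
  induction h using Relation.ReflTransGen.head_induction_on with
  | refl => exact .refl _
  | head h _ ih =>
    exact .trans _ _ _ (.rel _ _ ⟨⟨y, hw⟩, ⟨y, h.isLegal φ hw⟩, h.move⟩) (ih (h.isLegal φ hw))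

theorem diagramToRAAG_injective (x : X) : Function.Injective (φ.diagramToRAAG x) := by
  refine (injective_iff_map_eq_one _).2 ?_
  rintro ⟨w, hw⟩ h
  exact Quotient.sound ((reduces_nil_of_wordToRAAG_eq_one h).equivalent φ hw)

end SpecialColoring
end CubeComplex

/-! ### Paths which factor through a map -/

section Factors

variable {X Y : Type*} [TopologicalSpace X] [TopologicalSpace Y]

/-- The path `p` is the image under `G` of some path from `s` to `s'`. -/
def Factors (G : Y → X) (s s' : Y) {y y' : X} (p : Path y y') : Prop :=
  ∃ q : Path s s', ∀ t, p t = G (q t)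

variable {G : Y → X} {s s' s'' : Y} {x y z : X}

theorem Factors.source {p : Path x y} (h : Factors G s s' p) : G s = x := by
  obtain ⟨q, hq⟩ := h
  simpa using (hq 0).symm

theorem Factors.target {p : Path x y} (h : Factors G s s' p) : G s' = y := by
  obtain ⟨q, hq⟩ := h
  simpa using (hq 1).symm

theorem Factors.refl (G : Y → X) (s : Y) : Factors G s s (Path.refl (G s)) :=
  ⟨Path.refl s, fun _ => rfl⟩

theorem Factors.congr {G' : Y → X} {p : Path x y} (h : Factors G s s' p) (hG : G = G') :
    Factors G' s s' p := by
  subst hG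
  exact h

theorem Factors.symm {p : Path x y} (h : Factors G s s' p) : Factors G s' s p.symm := by
  obtain ⟨q, hq⟩ := h
  exact ⟨q.symm, fun t => hq _⟩

theorem Factors.trans {p : Path x y} {p' : Path y z} (h : Factors G s s' p)
    (h' : Factors G s' s'' p') : Factors G s s'' (p.trans p') := by
  obtain ⟨q, hq⟩ := h
  obtain ⟨q', hq'⟩ := h'
  refine ⟨q.trans q', fun t => ?_⟩
  rw [Path.trans_apply, Path.trans_apply]
  split_ifs
  · exact hq _
  · exact hq' _

theorem Factors.comp {Z : Type*} [TopologicalSpace Z] {g : Z → Y} (hg : Continuous g) {a b : Z}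
    {p : Path x y} (h : Factors (G ∘ g) a b p) : Factors G (g a) (g b) p := by
  obtain ⟨q, hq⟩ := h
  exact ⟨q.map hg, hq⟩

/-- The homotopy is the image of one in the simply connected space `Y`. Equal endpoints are required
in `Y`, not merely in `X`, since `G` need not be injective. -/
theorem Factors.homotopic [SimplyConnectedSpace Y] (hG : Continuous G) {p p' : Path x y}
    (h : Factors G s s' p) (h' : Factors G s s' p') : p.Homotopic p' := by
  obtain rfl := h.source
  obtain rfl := h.target
  obtain ⟨q, hq⟩ := h
  obtain ⟨q', hq'⟩ := h'
  obtain rfl : p = q.map hG := Path.ext (funext hq)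
  obtain rfl : p' = q'.map hG := Path.ext (funext hq')
  exact (SimplyConnectedSpace.paths_homotopic q q').map ⟨G, hG⟩

theorem exists_factors [PathConnectedSpace Y] (hG : Continuous G) (s s' : Y) (hx : G s = x)
    (hy : G s' = y) : ∃ p : Path x y, Factors G s s' p := by
  subst hx hy
  exact ⟨(PathConnectedSpace.somePath s s').map hG, _, fun _ => rfl⟩

end Factors

/-- Face maps send vertices to vertices. -/
theorem IsFaceMap.exists_vert {m n : ℕ} {f : (Fin m → I) → (Fin n → I)} (hf : IsFaceMap f)
    (ε : Fin m → Bool) : ∃ ε' : Fin n → Bool, f (vert ε) = vert ε' := by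
  have : ∀ j, ∃ b, f (vert ε) j = bit b := fun j => by
    rcases hf.coord j with ⟨i, h⟩ | ⟨i, h⟩ | h | h
    · exact ⟨ε i, h _⟩
    · refine ⟨!(ε i), (h _).trans ?_⟩
      cases hi : ε i <;> simp [vert, bit, hi]
    · exact ⟨false, h _⟩
    · exact ⟨true, h _⟩
  choose ε' h using this
  exact ⟨ε', funext h⟩

namespace CubeComplex

variable {X : Type u} [TopologicalSpace X] {K : CubeComplex X}

/-! ### Homotopies between paths of the one-skeleton -/

theorem isPath_append {x z : X} {γ γ' : List K.Edge} :
    K.IsPath x (γ ++ γ') z ↔ ∃ y, K.IsPath x γ y ∧ K.IsPath y γ' z := by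
  induction γ generalizing x with
  | nil => exact ⟨fun h => ⟨x, rfl, h⟩, fun ⟨_, h, h'⟩ => (show x = _ from h) ▸ h'⟩
  | cons e γ ih =>
    exact ⟨fun ⟨h, h'⟩ => (ih.1 h').imp fun y hy => ⟨⟨h, hy.1⟩, hy.2⟩,
      fun ⟨y, ⟨h, h'⟩, h''⟩ => ⟨h, ih.2 ⟨y, h', h''⟩⟩⟩

theorem IsPath.toPath_append {x y z : X} {γ γ' : List K.Edge} (h : K.IsPath x γ y)
    (h' : K.IsPath y γ' z) (h'' : K.IsPath x (γ ++ γ') z) :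
    h''.toPath.Homotopic (h.toPath.trans h'.toPath) := by
  induction γ generalizing x with
  | nil =>
    obtain rfl : x = y := h
    exact (Path.Homotopic.refl_trans _).symm
  | cons e γ ih =>
    exact ((Path.Homotopic.refl _).hcomp (ih h.2 h''.2)).trans
      (Path.Homotopic.trans_assoc _ _ _).symm

variable (K) in
/-- Two paths of the one-skeleton from `x` to `y` are homotopic in `X`. -/
def PathHomotopic (x y : X) (γ γ' : List K.Edge) : Prop :=
  ∃ (h : K.IsPath x γ y) (h' : K.IsPath x γ' y), h.toPath.Homotopic h'.toPath

theorem PathHomotopic.append_left {x y z : X} {γ δ δ' : List K.Edge} (hγ : K.IsPath x γ y)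
    (h : K.PathHomotopic y z δ δ') : K.PathHomotopic x z (γ ++ δ) (γ ++ δ') := by
  obtain ⟨h, h', hh⟩ := h
  refine ⟨isPath_append.2 ⟨y, hγ, h⟩, isPath_append.2 ⟨y, hγ, h'⟩, ?_⟩
  exact (hγ.toPath_append h _).trans
    (((Path.Homotopic.refl _).hcomp hh).trans (hγ.toPath_append h' _).symm)

theorem PathHomotopic.append_right {x y z : X} {γ δ δ' : List K.Edge} (hγ : K.IsPath y γ z)
    (h : K.PathHomotopic x y δ δ') : K.PathHomotopic x z (δ ++ γ) (δ' ++ γ) := by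
  obtain ⟨h, h', hh⟩ := h
  refine ⟨isPath_append.2 ⟨y, h, hγ⟩, isPath_append.2 ⟨y, h', hγ⟩, ?_⟩
  exact (h.toPath_append hγ _).trans
    ((hh.hcomp (Path.Homotopic.refl _)).trans (h'.toPath_append hγ _).symm)

theorem PathHomotopic.symm {x y : X} {γ γ' : List K.Edge} (h : K.PathHomotopic x y γ γ') :
    K.PathHomotopic x y γ' γ := by
  obtain ⟨h, h', hh⟩ := h
  exact ⟨h', h, hh.symm⟩

theorem PathHomotopic.trans {x y : X} {γ γ' γ'' : List K.Edge} (h : K.PathHomotopic x y γ γ')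
    (h' : K.PathHomotopic x y γ' γ'') : K.PathHomotopic x y γ γ'' := by
  obtain ⟨h₁, h₂, hh⟩ := h
  obtain ⟨h₃, h₄, hh'⟩ := h'
  exact ⟨h₁, h₄, hh.trans hh'⟩

theorem factors_toPath_nil {n : ℕ} (d : K.Cube n) {s : Fin n → I} {x y : X}
    (h : K.IsPath x [] y) (hs : d.1 s = x) : Factors d.1 s s h.toPath := by
  obtain rfl : x = y := h
  subst hs
  exact Factors.refl _ _

theorem factors_toPath_cons {n : ℕ} (d : K.Cube n) {s s' s'' : Fin n → I} {x y : X} {e : K.Edge}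
    {γ : List K.Edge} (h : K.IsPath x (e :: γ) y) (he : Factors d.1 s s' e.toPath)
    (hγ : Factors d.1 s' s'' h.2.toPath) : Factors d.1 s s'' h.toPath := by
  obtain ⟨rfl, h⟩ := h
  exact he.trans hγ

theorem factors_toPath_face {n : ℕ} (d : K.Cube n) (f : (Fin 1 → I) → (Fin n → I))
    (hf : IsFaceMap f) :
    Factors d.1 (f fun _ => 0) (f fun _ => 1) (d.face f hf).toPath :=
  ⟨{ toFun := fun t => f fun _ => t
     continuous_toFun := hf.continuous.comp (continuous_pi fun _ => continuous_id)
     source' := rfl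
     target' := rfl }, fun _ => rfl⟩

theorem factors_toPath_side {n : ℕ} (d : K.Cube n) (ε : Fin n → Bool) (i : Fin n) :
    Factors d.1 (vert (Function.update ε i false)) (vert (Function.update ε i true))
      (d.face (side ε i) (isFaceMap_side ε i)).toPath := by
  rw [vert_update, vert_update]
  exact factors_toPath_face d _ (isFaceMap_side ε i)

theorem factors_toPath_inv {Y : Type*} [TopologicalSpace Y] {G : Y → X} {s s' : Y} (e : K.Edge)
    (h : Factors G s s' e.toPath) : Factors G s' s e.inv.toPath := by
  obtain ⟨q, hq⟩ := h.symm
  exact ⟨q, hq⟩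

theorem pathHomotopic_inv (e : K.Edge) : K.PathHomotopic e.src e.src [e, e.inv] [] := by
  have h : K.IsPath e.src [e, e.inv] e.src :=
    ⟨rfl, SpecialColoring.src_inv e, SpecialColoring.tgt_inv e⟩
  have h' : K.IsPath e.src [] e.src := rfl
  have he : Factors e.1 (fun _ => 0) (fun _ => 1) e.toPath :=
    factors_toPath_face e _ (IsFaceMap.id 1)
  exact ⟨h, h', (factors_toPath_cons e h he (factors_toPath_cons e h.2 (factors_toPath_inv e he)
    (factors_toPath_nil e h.2.2 (SpecialColoring.tgt_inv e).symm))).homotopic e.continuous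
    (factors_toPath_nil e h' rfl)⟩

theorem pathHomotopic_square (q : K.Cube 2) :
    K.PathHomotopic (q.edge 0).src q.opp.tgt
      [q.edge 0, (q.face diag isFaceMap_diag).opp] [q.edge 1, q.opp] := by
  have h₁ : K.IsPath (q.edge 0).src [q.edge 0, (q.face diag isFaceMap_diag).opp] q.opp.tgt := by
    refine ⟨rfl, ?_, ?_⟩ <;> refine congrArg q.1 (funext fun j => ?_) <;>
      fin_cases j <;> simp [diag, axis, top]
  have h₂ : K.IsPath (q.edge 0).src [q.edge 1, q.opp] q.opp.tgt := by
    refine ⟨?_, ?_, rfl⟩ <;> refine congrArg q.1 (funext fun j => ?_) <;>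
      fin_cases j <;> simp [axis, top]
  have f₁ : Factors q.1 (fun _ => 0) ![1, 0] (q.edge 0).toPath := by
    convert! factors_toPath_face q _ (isFaceMap_axis 0) using 1 <;>
      funext j <;> fin_cases j <;> simp [axis]
  have f₂ : Factors q.1 ![1, 0] (fun _ => 1) (q.face diag isFaceMap_diag).opp.toPath := by
    convert! factors_toPath_face q _ (isFaceMap_diag.comp isFaceMap_top) using 1 <;>
      funext j <;> fin_cases j <;> simp [diag, top]
  have f₃ : Factors q.1 (fun _ => 0) ![0, 1] (q.edge 1).toPath := by
    convert! factors_toPath_face q _ (isFaceMap_axis 1) using 1 <;>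
      funext j <;> fin_cases j <;> simp [axis]
  have f₄ : Factors q.1 ![0, 1] (fun _ => 1) q.opp.toPath := by
    convert! factors_toPath_face q _ isFaceMap_top using 1 <;>
      funext j <;> fin_cases j <;> simp [top]
  exact ⟨h₁, h₂, (factors_toPath_cons q h₁ f₁ (factors_toPath_cons q h₁.2 f₂
    (factors_toPath_nil q h₁.2.2 (f₂.target)))).homotopic q.continuous
    (factors_toPath_cons q h₂ f₃ (factors_toPath_cons q h₂.2 f₄
    (factors_toPath_nil q h₂.2.2 (f₄.target))))⟩

namespace SpecialColoring

variable {V : Type v} {Δ : SimpleGraph V} (φ : K.SpecialColoring Δ)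

/-- A path of the one-skeleton is determined by its origin and its word. -/
theorem eq_of_map_color_eq {x y y' : X} {γ γ' : List K.Edge} (h : K.IsPath x γ y)
    (h' : K.IsPath x γ' y') (hγ : γ.map φ.color = γ'.map φ.color) : γ = γ' := by
  induction γ generalizing x γ' with
  | nil => exact (List.map_eq_nil_iff.1 hγ.symm).symm
  | cons e γ ih =>
    cases γ' with
    | nil => simp at hγ
    | cons e' γ' =>
      simp only [List.map_cons, List.cons.injEq] at hγ
      obtain rfl := φ.eq_of_color_eq e e' (h.1.trans h'.1.symm) hγ.1
      rw [ih h.2 h'.2 hγ.2]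

/-- Paths being determined by their origin and word, the two paths share a prefix and a suffix and
differ by a backtrack. -/
theorem pathHomotopic_of_cancellation {x y : X} {u w : List (Color V)} {c : Color V}
    {γ γ' : List K.Edge} (h : K.IsPath x γ y) (h' : K.IsPath x γ' y)
    (hγ : γ.map φ.color = u ++ c :: c.inv :: w) (hγ' : γ'.map φ.color = u ++ w) :
    K.PathHomotopic x y γ γ' := by
  obtain ⟨γ₁, δ, rfl, rfl, hδ⟩ := List.map_eq_append_iff.1 hγ
  obtain ⟨e, δ, rfl, rfl, hδ⟩ := List.map_eq_cons_iff.1 hδ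
  obtain ⟨f, γ₂, rfl, hf, rfl⟩ := List.map_eq_cons_iff.1 hδ
  obtain ⟨γ₁', γ₂', rfl, hu, hw⟩ := List.map_eq_append_iff.1 hγ'
  obtain ⟨z, h₁, he, hf', h₂⟩ := isPath_append.1 h
  obtain ⟨z', h₁', h₂'⟩ := isPath_append.1 h'
  obtain rfl := φ.eq_of_map_color_eq h₁ h₁' hu.symm
  have hff : f = e.inv := φ.eq_of_color_eq f e.inv (hf'.trans (src_inv e).symm)
    (hf.trans (φ.color_inv e).symm)
  subst hff
  subst he
  rw [tgt_inv] at h₂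
  have hz : z' = e.src := IsLegal.unique φ ⟨γ₁, h₁', rfl⟩ ⟨γ₁, h₁, rfl⟩
  subst hz
  obtain rfl := φ.eq_of_map_color_eq h₂ h₂' hw.symm
  exact PathHomotopic.append_left h₁ ((pathHomotopic_inv e).append_right h₂)

/-- The square spanned by the first edges of the two differing segments contains the second edges as
well, because edges with a given origin are determined by their colors. -/
theorem pathHomotopic_of_commutation {x y : X} {u w : List (Color V)} {c d : Color V}
    (hcd : Δ.Adj c.1 d.1) {γ γ' : List K.Edge} (h : K.IsPath x γ y) (h' : K.IsPath x γ' y)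
    (hγ : γ.map φ.color = u ++ c :: d :: w) (hγ' : γ'.map φ.color = u ++ d :: c :: w) :
    K.PathHomotopic x y γ γ' := by
  obtain ⟨γ₁, δ, rfl, rfl, hδ⟩ := List.map_eq_append_iff.1 hγ
  obtain ⟨e, ζ, rfl, rfl, hζ⟩ := List.map_eq_cons_iff.1 hδ
  obtain ⟨f, γ₂, rfl, rfl, rfl⟩ := List.map_eq_cons_iff.1 hζ
  obtain ⟨γ₁', δ', rfl, hu, hδ'⟩ := List.map_eq_append_iff.1 hγ'
  obtain ⟨f', ζ', rfl, hf', hζ'⟩ := List.map_eq_cons_iff.1 hδ'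
  obtain ⟨e', γ₂', rfl, he', hw⟩ := List.map_eq_cons_iff.1 hζ'
  obtain ⟨z, h₁, he, hf, h₂⟩ := isPath_append.1 h
  obtain ⟨z', h₁', hf'', he'', h₂'⟩ := isPath_append.1 h'
  obtain rfl := φ.eq_of_map_color_eq h₁ h₁' hu.symm
  have hz : z' = z := IsLegal.unique φ ⟨γ₁, h₁', rfl⟩ ⟨γ₁, h₁, rfl⟩
  subst hz
  obtain ⟨q, rfl, rfl⟩ := φ.spanSquare_of_adj e f' (he.trans hf''.symm) (by
    change Δ.Adj _ (φ.color f').1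
    rw [hf']
    exact hcd)
  obtain ⟨p₁, p₂, hp⟩ := pathHomotopic_square q
  have key : K.Parallel (q.edge 1) (q.face diag isFaceMap_diag).opp := by
    refine ⟨q.face diag isFaceMap_diag, ?_, rfl⟩
    refine Subtype.ext (funext fun x => congrArg q.1 (funext fun j => ?_))
    fin_cases j <;> simp [diag, axis]
  have key' : K.Parallel (q.edge 0) q.opp := ⟨q, rfl, rfl⟩
  have hff : f = (q.face diag isFaceMap_diag).opp :=
    φ.eq_of_color_eq _ _ (hf.trans p₁.2.1.symm) (hf'.symm.trans (congrArg φ.φ (Quot.sound key)))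
  have hee : e' = q.opp :=
    φ.eq_of_color_eq _ _ (he''.trans p₂.2.1.symm) (he'.trans (congrArg φ.φ (Quot.sound key')))
  subst hff hee he
  have ht : ((q.face diag isFaceMap_diag).opp).tgt = q.opp.tgt := p₁.2.2
  rw [ht] at h₂
  obtain rfl := φ.eq_of_map_color_eq h₂ h₂' hw.symm
  exact PathHomotopic.append_left h₁ (PathHomotopic.append_right h₂ ⟨p₁, p₂, hp⟩)

theorem pathHomotopic_of_move {x y : X} {γ γ' : List K.Edge} (h : K.IsPath x γ y)
    (h' : K.IsPath x γ' y) (hm : Move Δ (γ.map φ.color) (γ'.map φ.color)) :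
    K.PathHomotopic x y γ γ' := by
  generalize hγ : γ.map φ.color = w at hm
  generalize hγ' : γ'.map φ.color = w' at hm
  cases hm with
  | cancellation u w c => exact φ.pathHomotopic_of_cancellation h h' hγ hγ'
  | insertion u w c => exact (φ.pathHomotopic_of_cancellation h' h hγ' hγ).symm
  | commutation u w c d hcd => exact φ.pathHomotopic_of_commutation hcd h h' hγ hγ'

/-- Paths of the one-skeleton which are labelled by equivalent words are homotopic. -/
theorem pathHomotopic_of_equivalent {x y : X} {w w' : List (Color V)} (hw : φ.Equivalent x w w')
    {γ γ' : List K.Edge} (h : K.IsPath x γ y) (h' : K.IsPath x γ' y) (hγ : γ.map φ.color = w)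
    (hγ' : γ'.map φ.color = w') : K.PathHomotopic x y γ γ' := by
  induction hw generalizing γ γ' with
  | rel _ _ hm =>
    subst hγ hγ'
    exact φ.pathHomotopic_of_move h h' hm.2.2
  | refl _ =>
    obtain rfl := φ.eq_of_map_color_eq h h' (hγ.trans hγ'.symm)
    exact ⟨h, h, .refl _⟩
  | symm _ _ _ ih => exact (ih h' h hγ' hγ).symm
  | trans _ _ _ h₁ _ ih ih' =>
    -- The intermediate word is legal with the same terminus, so it labels a path through which the
    -- homotopy can pass.
    obtain ⟨δ, hδ, hδw⟩ := (Equivalent.isLegal_iff φ h₁ y).1 ⟨γ, h, hγ⟩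
    exact (ih h hδ hγ hδw).trans (ih' hδ h' hδw hγ')

end SpecialColoring
end CubeComplex
namespace CubeComplex

variable {X : Type u} [TopologicalSpace X] {K : CubeComplex X}

/-! ### Combinatorial approximation of paths -/

variable (K) in
/-- The path `p` is homotopic to a path of the one-skeleton. -/
def IsEdgePath {x y : X} (p : Path x y) : Prop :=
  ∃ (γ : List K.Edge) (h : K.IsPath x γ y), p.Homotopic h.toPath

theorem IsEdgePath.of_homotopic {x y : X} {p p' : Path x y} (h : K.IsEdgePath p)
    (hp : p'.Homotopic p) : K.IsEdgePath p' := by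
  obtain ⟨γ, h, hh⟩ := h
  exact ⟨γ, h, hp.trans hh⟩

theorem IsEdgePath.trans {x y z : X} {p : Path x y} {p' : Path y z} (h : K.IsEdgePath p)
    (h' : K.IsEdgePath p') : K.IsEdgePath (p.trans p') := by
  obtain ⟨γ, h, hh⟩ := h
  obtain ⟨γ', h', hh'⟩ := h'
  exact ⟨γ ++ γ', isPath_append.2 ⟨y, h, h'⟩, (hh.hcomp hh').trans (h.toPath_append h' _).symm⟩

theorem isEdgePath_of_factors_vert_update {n : ℕ} (d : K.Cube n) (ε : Fin n → Bool) (j : Fin n)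
    (b : Bool) {x y : X} {p : Path x y}
    (hp : Factors d.1 (vert ε) (vert (Function.update ε j b)) p) : K.IsEdgePath p := by
  by_cases hb : ε j = b
  · rw [Function.update_eq_self_iff.2 hb.symm] at hp
    have hxy : x = y := hp.source.symm.trans hp.target
    exact ⟨[], hxy, hp.homotopic d.continuous (factors_toPath_nil d hxy hp.source)⟩
  · have key : ∃ e : K.Edge, Factors d.1 (vert ε) (vert (Function.update ε j b)) e.toPath := by
      have h := factors_toPath_side d ε j
      have hε := Function.update_eq_self j ε
      cases b
      · rw [Bool.not_eq_false] at hb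
        rw [hb] at hε
        rw [hε] at h
        exact ⟨_, factors_toPath_inv _ h⟩
      · rw [Bool.not_eq_true] at hb
        rw [hb] at hε
        rw [hε] at h
        exact ⟨_, h⟩
    obtain ⟨e, he⟩ := key
    have h : K.IsPath x [e] y := ⟨he.source.symm.trans hp.source, he.target.symm.trans hp.target⟩
    exact ⟨[e], h, hp.homotopic d.continuous
      (factors_toPath_cons d h he (factors_toPath_nil d h.2 he.target))⟩

/-- In a cube, a path between two vertices is homotopic to a path of the one-skeleton. -/
theorem isEdgePath_of_factors_vert {n : ℕ} (d : K.Cube n) (ε ε' : Fin n → Bool) {x y : X}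
    {p : Path x y} (hp : Factors d.1 (vert ε) (vert ε') p) : K.IsEdgePath p := by
  classical
  -- The coordinates of `ε` are replaced by those of `ε'` one at a time, each change costing at most
  -- one edge.
  have key : ∀ (S : Finset (Fin n)) {y : X} {p : Path x y},
      Factors d.1 (vert ε) (vert (S.piecewise ε' ε)) p → K.IsEdgePath p := by
    intro S
    induction S using Finset.induction_on with
    | empty =>
      intro y p hp
      rw [Finset.piecewise_empty] at hp
      have hxy : x = y := hp.source.symm.trans hp.target
      exact ⟨[], hxy, hp.homotopic d.continuous (factors_toPath_nil d hxy hp.source)⟩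
    | insert j S _ ih =>
      intro y p hp
      rw [Finset.piecewise_insert] at hp
      obtain ⟨q, hq⟩ := exists_factors d.continuous (vert ε) (vert (S.piecewise ε' ε))
        hp.source rfl
      have hq' := hq.symm.trans hp
      exact ((ih hq).trans (isEdgePath_of_factors_vert_update d _ j _ hq')).of_homotopic
        (hp.homotopic d.continuous (hq.trans hq'))
  have h := key Finset.univ (p := p)
  rw [Finset.piecewise_univ] at h
  exact h hp

theorem homotopic_trans_symm_trans {x y z w : X} (p : Path x y) (r : Path y w) (p' : Path y z) :
    (p.trans p').Homotopic ((p.trans r).trans (r.symm.trans p')) := by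
  rw [← Path.Homotopic.Quotient.eq]
  simp only [Path.Homotopic.Quotient.mk_trans, Path.Homotopic.Quotient.mk_symm]
  rw [Path.Homotopic.Quotient.trans_assoc, ← Path.Homotopic.Quotient.trans_assoc (.mk r),
    Path.Homotopic.Quotient.trans_symm, Path.Homotopic.Quotient.refl_trans]

/-- A path which goes from a vertex of a cube `d` to a vertex of a cube `d'`, in `d` and then in
`d'`, is homotopic to a path of the one-skeleton. -/
theorem isEdgePath_trans_of_factors {m n : ℕ} (d : K.Cube m) (d' : K.Cube n) {ε : Fin m → Bool}
    {s : Fin m → I} {s' : Fin n → I} {ε' : Fin n → Bool} {x y z : X} {p : Path x y}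
    {p' : Path y z} (hp : Factors d.1 (vert ε) s p) (hp' : Factors d'.1 s' (vert ε') p') :
    K.IsEdgePath (p.trans p') := by
  obtain ⟨k, v, v', a, hv, hv', -, rfl, rfl, hd⟩ :=
    exists_common_face d d' (hp.target.trans hp'.source.symm)
  have hc : Continuous (d.1 ∘ v) := d.continuous.comp hv.continuous
  -- The detour from the junction to a vertex stays in the common face, so it can be read in `d` and
  -- in `d'`.
  obtain ⟨r, hr⟩ := exists_factors hc a (vert fun _ => false) hp.target rfl
  have hr' := hr.congr hd
  have hr := Factors.comp hv.continuous hr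
  have hr' := Factors.comp hv'.continuous hr'
  obtain ⟨η, hη⟩ := hv.exists_vert fun _ => false
  obtain ⟨η', hη'⟩ := hv'.exists_vert fun _ => false
  rw [hη] at hr
  rw [hη'] at hr'
  exact ((isEdgePath_of_factors_vert d _ _ (hp.trans hr)).trans
    (isEdgePath_of_factors_vert d' _ _ (hr'.symm.trans hp'))).of_homotopic
    (homotopic_trans_symm_trans p r p')

variable (K) in
/-- The paths which are homotopic to a concatenation of paths contained in cubes. -/
inductive IsChain : ∀ {x y : X}, Path x y → Prop
  | factors {n : ℕ} (d : K.Cube n) (s s' : Fin n → I) {x y : X} (p : Path x y)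
      (hp : Factors d.1 s s' p) : IsChain p
  | trans {x y z : X} {p : Path x y} {p' : Path y z} (hp : IsChain p) (hp' : IsChain p') :
      IsChain (p.trans p')
  | of_homotopic {x y : X} {p p' : Path x y} (hp : IsChain p) (h : p'.Homotopic p) : IsChain p'

theorem isChain_refl (x : X) : K.IsChain (Path.refl x) := by
  obtain ⟨n, c, hc, t, -, rfl⟩ := K.cover x
  exact .factors ⟨c, hc⟩ t t _ (Factors.refl c t)

theorem isChain_cast_iff {x y x' y' : X} (p : Path x y) (hx : x' = x) (hy : y' = y) :
    K.IsChain (p.cast hx hy) ↔ K.IsChain p := by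
  subst hx hy
  rfl

/-- The endpoints of the pieces of a chain are arbitrary points, so the induction needs tails `r`
and `r'` joining them to vertices inside cubes. At each junction a detour to a vertex and back is
inserted. -/
theorem IsChain.isEdgePath_trans {x y : X} {p : Path x y} (h : K.IsChain p) {m n : ℕ}
    (d : K.Cube m) (d' : K.Cube n) {ε : Fin m → Bool} {s : Fin m → I} {s' : Fin n → I}
    {ε' : Fin n → Bool} {w z : X} {r : Path w x} {r' : Path y z}
    (hr : Factors d.1 (vert ε) s r) (hr' : Factors d'.1 s' (vert ε') r') :
    K.IsEdgePath ((r.trans p).trans r') := by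
  induction h generalizing m n w z with
  | factors d₀ a b p hp =>
    obtain ⟨u, hu⟩ := exists_factors d₀.continuous a (vert fun _ => false) hp.source rfl
    have h1 := isEdgePath_trans_of_factors d d₀ hr hu
    have h2 := isEdgePath_trans_of_factors d₀ d' (hu.symm.trans hp) hr'
    refine (h1.trans h2).of_homotopic ((Path.Homotopic.trans_assoc _ _ _).trans
      ((homotopic_trans_symm_trans r u (p.trans r')).trans ?_))
    exact (Path.Homotopic.refl _).hcomp (Path.Homotopic.trans_assoc _ _ _).symm
  | @trans x y z p p' _ _ ih ih' =>
    obtain ⟨k, c, hc, t, -, ht⟩ := K.cover y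
    obtain ⟨u, hu⟩ := exists_factors (Cube.continuous ⟨c, hc⟩) t (vert fun _ => false) ht rfl
    have h1 := ih d ⟨c, hc⟩ hr hu
    have h2 := ih' ⟨c, hc⟩ d' hu.symm hr'
    refine (h1.trans h2).of_homotopic ?_
    refine (((Path.Homotopic.trans_assoc r p p').symm.hcomp (.refl r')).trans
      (Path.Homotopic.trans_assoc (r.trans p) p' r')).trans
      ((homotopic_trans_symm_trans (r.trans p) u (p'.trans r')).trans ?_)
    exact (Path.Homotopic.refl _).hcomp (Path.Homotopic.trans_assoc _ _ _).symm
  | of_homotopic _ h ih =>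
    exact (ih d d' hr hr').of_homotopic (((Path.Homotopic.refl _).hcomp h).hcomp (.refl _))

theorem factors_refl_of_isVertex {x : X} (hx : K.IsVertex x) :
    ∃ c : K.Cube 0, Factors c.1 (vert fun _ => false) (vert fun _ => false) (Path.refl x) := by
  obtain ⟨c, rfl⟩ := hx
  exact ⟨c, Factors.refl _ _⟩

theorem IsChain.isEdgePath {x y : X} {p : Path x y} (h : K.IsChain p) (hx : K.IsVertex x)
    (hy : K.IsVertex y) : K.IsEdgePath p := by
  obtain ⟨c, hc⟩ := factors_refl_of_isVertex hx
  obtain ⟨c', hc'⟩ := factors_refl_of_isVertex hy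
  exact (h.isEdgePath_trans c c' hc hc').of_homotopic ((Path.Homotopic.refl_trans p).symm.trans
    (Path.Homotopic.trans_refl _).symm)

/-! ### Contraction of the open stars -/

/-- The contraction of an open star along segments. -/
theorem exists_contraction {n : ℕ} (c : K.Cube n) {t : Fin n → I} {δ : ℝ} (ht : Deep δ t) :
    ∃ h : X → C(I, X), ContinuousOn h (K.star c t (δ / 2)) ∧
      ∀ (m : ℕ) (d : K.Cube m) (f : (Fin n → I) → (Fin m → I)) (s : Fin m → I), IsFaceMap f →
        d.1 ∘ f = c.1 → dist s (f t) < δ / 2 → ∀ τ, h (d.1 s) τ = d.1 (segment s (f t) τ) := by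
  classical
  let curried : ∀ {m : ℕ} (d : K.Cube m) (a : Fin m → I), C(Fin m → I, C(I, X)) := fun d a =>
    ContinuousMap.curry ⟨fun p => d.1 (segment p.1 a p.2), d.continuous.comp
      (continuous_segment.comp (by fun_prop :
        Continuous fun p : (Fin _ → I) × I => (p.1, a, p.2)))⟩
  have hδ : ∀ {m : ℕ} {s a : Fin m → I}, dist s a < δ / 2 → 0 < δ := fun h => by
    linarith [dist_nonneg.trans_lt h]
  have ht' : 0 < δ → Deep (δ / 2) t := fun hδ =>
    ⟨by linarith [ht.1], fun i => ⟨by linarith [(ht.2 i).1], by linarith [(ht.2 i).2]⟩⟩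
  -- The segment from a point to the center is independent of the cube in which it is drawn. Two
  -- cubes share a face containing both ends, and the radius `δ / 2` keeps two lifts of the center
  -- within `δ`, hence equal.
  have key : ∀ y : X, ∃ g : C(I, X), ∀ (m : ℕ) (d : K.Cube m) (f : (Fin n → I) → (Fin m → I))
      (s : Fin m → I), IsFaceMap f → d.1 ∘ f = c.1 → dist s (f t) < δ / 2 → d.1 s = y →
        g = curried d (f t) s := by
    intro y
    by_cases hy : y ∈ K.star c t (δ / 2)
    · obtain ⟨m, d, f, s, hf, hc, hs, rfl⟩ := hy
      refine ⟨curried d (f t) s, fun m' d' f' s' hf' hc' hs' h => ?_⟩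
      obtain ⟨k, v, v', f'', s₀, t₀, hv, hv', hf'', hd, hc'', rfl, rfl, h1, h2⟩ :=
        exists_common_face_of_dist_lt (ht' (hδ hs)) d d' hf hc hs h.symm
      have h3 : dist (v' s₀) (f'' t) < δ / 2 := by
        rwa [← h2, hv'.dist_eq, ← hv.dist_eq, h1]
      have h4 : f' t = f'' t := eq_of_dist_lt ht d' hf' hf'' hc' hc'' (by
        linarith [dist_triangle (f'' t) (v' s₀) (f' t), dist_comm (v' s₀) (f'' t)])
      ext τ
      change d.1 (segment (v s₀) (f t) τ) = d'.1 (segment (v' s₀) (f' t) τ)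
      rw [h4, ← h1, ← h2, ← hv.segment, ← hv'.segment]
      exact congrFun hd _
    · exact ⟨.const I y, fun m d f s hf hc hs h => (hy ⟨m, d, f, s, hf, hc, hs, h⟩).elim⟩
  choose h hh using key
  refine ⟨h, ?_, fun m d f s hf hc hs τ => by rw [hh _ m d f s hf hc hs rfl]; rfl⟩
  -- Positivity of `δ` is not assumed, but otherwise the star is empty.
  by_cases hδ0 : 0 < δ
  swap
  · have : K.star c t (δ / 2) = ∅ :=
      Set.eq_empty_of_forall_notMem fun y ⟨m, d, f, s, _, _, hs, _⟩ => hδ0 (hδ hs)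
    rw [this]
    exact continuousOn_empty h
  refine (continuousOn_open_iff (isOpen_star (ht' hδ0))).2 fun W hW => ?_
  refine (K.isOpen_iff _).2 fun m d hd => ?_
  have : d ⁻¹' (K.star c t (δ / 2) ∩ h ⁻¹' W) =
      ⋃ f ∈ {f : (Fin n → I) → (Fin m → I) | IsFaceMap f ∧ d ∘ f = c.1},
        Metric.ball (f t) (δ / 2) ∩ curried ⟨d, hd⟩ (f t) ⁻¹' W := by
    ext s
    simp only [Set.mem_preimage, Set.mem_inter_iff, Set.mem_iUnion, Set.mem_ofPred_eq,
      Metric.mem_ball, exists_prop, mem_star_iff (ht' hδ0) ⟨d, hd⟩ s]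
    constructor
    · rintro ⟨⟨f, hf, hc, hs⟩, hW⟩
      rw [hh _ m ⟨d, hd⟩ f s hf hc hs rfl] at hW
      exact ⟨f, ⟨hf, hc⟩, hs, hW⟩
    · rintro ⟨f, ⟨hf, hc⟩, hs, hW⟩
      refine ⟨⟨f, hf, hc, hs⟩, ?_⟩
      rwa [hh _ m ⟨d, hd⟩ f s hf hc hs rfl]
  rw [this]
  exact isOpen_biUnion fun f _ => Metric.isOpen_ball.inter (hW.preimage (curried _ _).continuous)

/-- Every point has a neighborhood in which all paths are homotopic to concatenations of paths
contained in cubes. -/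
theorem exists_isChain_nhds (x : X) : ∃ U : Set X, IsOpen U ∧ x ∈ U ∧
    ∀ {a b : X} (p : Path a b), (∀ τ, p τ ∈ U) → K.IsChain p := by
  obtain ⟨n, c, hc, t, ht, rfl⟩ := K.cover x
  obtain ⟨δ, hδ, hd⟩ := exists_deep ht
  have hd' : Deep (δ / 2) t :=
    ⟨by linarith [hd.1], fun i => ⟨by linarith [(hd.2 i).1], by linarith [(hd.2 i).2]⟩⟩
  obtain ⟨h, hcont, hh⟩ := exists_contraction ⟨c, hc⟩ hd
  refine ⟨K.star ⟨c, hc⟩ t (δ / 2), isOpen_star hd', mem_star_self ⟨c, hc⟩ t (half_pos hδ), ?_⟩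
  intro a b p hp
  have h0 : ∀ y ∈ K.star ⟨c, hc⟩ t (δ / 2), h y 0 = y := by
    rintro y ⟨m, d, f, s, hf, hc, hs, rfl⟩
    rw [hh m d f s hf hc hs, segment_zero]
  have h1 : ∀ y ∈ K.star ⟨c, hc⟩ t (δ / 2), h y 1 = c t := by
    rintro y ⟨m, d, f, s, hf, hc, hs, rfl⟩
    rw [hh m d f s hf hc hs, segment_one]
    exact congrFun hc t
  have ha : a ∈ K.star ⟨c, hc⟩ t (δ / 2) := by simpa using hp 0
  have hb : b ∈ K.star ⟨c, hc⟩ t (δ / 2) := by simpa using hp 1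
  let ray : ∀ y ∈ K.star ⟨c, hc⟩ t (δ / 2), Path y (c t) := fun y hy =>
    ⟨h y, h0 y hy, h1 y hy⟩
  have hray : ∀ y hy, K.IsChain (ray y hy) := by
    rintro y ⟨m, d, f, s, hf, hc, hs, rfl⟩
    exact .factors d s (f t) _ ⟨segmentPath s (f t), fun τ => hh m d f s hf hc hs τ⟩
  have hray' : ∀ y hy, K.IsChain (ray y hy).symm := by
    rintro y ⟨m, d, f, s, hf, hc, hs, rfl⟩
    exact .factors d (f t) s _
      (Factors.symm ⟨segmentPath s (f t), fun τ => hh m d f s hf hc hs τ⟩)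
  refine .of_homotopic ((hray a ha).trans (hray' b hb)) ?_
  -- The first coordinate runs along `p`, the second along the contraction; the sides of this square
  -- are `p`, the two rays and a constant path.
  let G : (Fin 2 → I) → X := fun z => h (p (z 0)) (z 1)
  have hG : Continuous G := by
    have : Continuous fun s => h (p s) := hcont.comp_continuous p.continuous hp
    exact (ContinuousMap.continuous_uncurry_of_continuous ⟨_, this⟩).comp
      (by fun_prop : Continuous fun z : Fin 2 → I => (z 0, z 1))
  have hline : ∀ (q : I → Fin 2 → I) (hq : Continuous q), ∃ r : Path (q 0) (q 1), ∀ τ, r τ = q τ :=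
    fun q hq => ⟨⟨⟨q, hq⟩, rfl, rfl⟩, fun _ => rfl⟩
  have g₁ : Factors G ![0, 0] ![1, 0] p := by
    obtain ⟨r, hr⟩ := hline (fun τ => ![τ, 0]) (by fun_prop)
    exact ⟨r, fun τ => by rw [hr]; exact (h0 _ (hp τ)).symm⟩
  have g₂ : Factors G ![0, 0] ![0, 1] (ray a ha) := by
    obtain ⟨r, hr⟩ := hline (fun τ => ![0, τ]) (by fun_prop)
    exact ⟨r, fun τ => by rw [hr]; simp [G, ray]⟩
  have g₃ : Factors G ![1, 0] ![1, 1] (ray b hb) := by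
    obtain ⟨r, hr⟩ := hline (fun τ => ![1, τ]) (by fun_prop)
    exact ⟨r, fun τ => by rw [hr]; simp [G, ray]⟩
  have g₄ : Factors G ![0, 1] ![1, 1] (Path.refl (c t)) := by
    obtain ⟨r, hr⟩ := hline (fun τ => ![τ, 1]) (by fun_prop)
    exact ⟨r, fun τ => by rw [hr]; exact (h1 _ (hp τ)).symm⟩
  exact (g₁.homotopic hG ((g₂.trans g₄).trans g₃.symm)).trans
    ((Path.Homotopic.trans_refl _).hcomp (.refl _))

/-- Every path is homotopic to a concatenation of paths contained in cubes. -/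
theorem isChain {x y : X} (p : Path x y) : K.IsChain p := by
  choose U hUo hU hUp using exists_isChain_nhds (K := K)
  -- Lebesgue subdivision of `[0,1]`, each step of which stays in one good neighborhood.
  obtain ⟨t, t0, tmono, ⟨N, hN⟩, ht⟩ := exists_monotone_Icc_subset_open_cover_unitInterval
    (c := fun z => p ⁻¹' U z) (fun z => (hUo z).preimage p.continuous)
    fun τ _ => Set.mem_iUnion.2 ⟨p τ, hU _⟩
  have key : ∀ k, K.IsChain (p.subpath 0 (t k)) := by
    intro k
    induction k with
    | zero =>
      rw [t0, Path.subpath_self]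
      exact isChain_refl _
    | succ k ih =>
      refine .of_homotopic (ih.trans ?_) ⟨(Path.Homotopy.subpathTransSubpath p 0 (t k) _).symm⟩
      obtain ⟨z, hz⟩ := ht k
      refine hUp z _ fun τ => hz ?_
      have : p.subpath (t k) (t (k + 1)) τ = p (Set.Icc.convexComb (t k) (t (k + 1)) τ) := rfl
      have hle : (t k : ℝ) ≤ t (k + 1) := tmono k.le_succ
      have h0 := τ.2.1
      have h1 := τ.2.2
      constructor
      · change (t k : ℝ) ≤ _
        rw [Set.Icc.coe_convexComb]
        nlinarith
      · change _ ≤ (t (k + 1) : ℝ)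
        rw [Set.Icc.coe_convexComb]
        nlinarith
  have := key N
  rw [hN N le_rfl, Path.subpath_zero_one, isChain_cast_iff] at this
  exact this

/-- Cellular approximation for paths: a path between two vertices is homotopic to a path of the
one-skeleton. -/
theorem isEdgePath {x y : X} (hx : K.IsVertex x) (hy : K.IsVertex y) (p : Path x y) :
    K.IsEdgePath p :=
  (isChain p).isEdgePath hx hy

/-- Every point can be joined to a vertex. -/
theorem exists_path_to_vertex (K : CubeComplex X) (p : X) :
    ∃ x, K.IsVertex x ∧ Nonempty (Path p x) := by
  obtain ⟨n, c, hc, t, -, rfl⟩ := K.cover p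
  obtain ⟨q, -⟩ := exists_factors (Cube.continuous ⟨c, hc⟩) t (vert fun _ => false)
    (rfl : c t = c t) rfl
  refine ⟨_, ⟨Cube.face ⟨c, hc⟩ (fun _ => vert fun _ => false) ?_, rfl⟩, ⟨q⟩⟩
  exact ⟨⟨Fin.elim0, fun a => a.elim0⟩, fun i => i.elim0, fun j _ => .inl fun _ => rfl⟩

end CubeComplex
namespace CubeComplex

variable {X : Type u} [TopologicalSpace X] {K : CubeComplex X}

namespace SpecialColoring

variable {V : Type v} {Δ : SimpleGraph V} (φ : K.SpecialColoring Δ)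

/-! ### Diagram groups and fundamental groups -/

/-- The homotopy class of the closed paths labelled by a spherical diagram. -/
noncomputable def homotopyClass (x : X) : φ.Diagram x → Path.Homotopic.Quotient x x :=
  Quotient.lift (fun a => .mk a.2.choose_spec.1.toPath) fun a b h => by
    obtain ⟨_, _, hh⟩ := φ.pathHomotopic_of_equivalent h a.2.choose_spec.1 b.2.choose_spec.1
      a.2.choose_spec.2 b.2.choose_spec.2
    exact Path.Homotopic.Quotient.eq.2 hh

theorem homotopyClass_diagramOfPath {x : X} {γ : List K.Edge} (h : K.IsPath x γ x) :
    φ.homotopyClass x (φ.diagramOfPath h) = .mk h.toPath := by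
  have hl : φ.IsLegal x (γ.map φ.color) x := ⟨γ, h, rfl⟩
  obtain ⟨_, _, hh⟩ := φ.pathHomotopic_of_equivalent (.refl _) hl.choose_spec.1 h
    hl.choose_spec.2 rfl
  exact Path.Homotopic.Quotient.eq.2 hh

theorem exists_diagramOfPath_eq {x : X} (a : φ.Diagram x) :
    ∃ (γ : List K.Edge) (h : K.IsPath x γ x), φ.diagramOfPath h = a := by
  obtain ⟨w, γ, h, rfl⟩ := a
  exact ⟨γ, h, rfl⟩

theorem diagramOfPath_mul {x : X} {γ γ' : List K.Edge} (h : K.IsPath x γ x)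
    (h' : K.IsPath x γ' x) : φ.diagramOfPath h * φ.diagramOfPath h' =
      φ.diagramOfPath (isPath_append.2 ⟨x, h, h'⟩) :=
  congrArg (Quotient.mk _) (Subtype.ext List.map_append.symm)

theorem homotopyClass_mul {x : X} (a b : φ.Diagram x) :
    φ.homotopyClass x (a * b) = (φ.homotopyClass x a).trans (φ.homotopyClass x b) := by
  obtain ⟨γ, h, rfl⟩ := φ.exists_diagramOfPath_eq a
  obtain ⟨γ', h', rfl⟩ := φ.exists_diagramOfPath_eq b
  rw [diagramOfPath_mul]
  simp only [homotopyClass_diagramOfPath]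
  rw [← Path.Homotopic.Quotient.mk_trans]
  exact Path.Homotopic.Quotient.eq.2 (h.toPath_append h' _)

/-- The covering defined by the coloring shows that homotopic loops have the same image in `A(Δ)`,
and diagrams are detected there. -/
theorem homotopyClass_injective (x : X) : Function.Injective (φ.homotopyClass x) := by
  intro a b hab
  obtain ⟨γ, h, rfl⟩ := φ.exists_diagramOfPath_eq a
  obtain ⟨γ', h', rfl⟩ := φ.exists_diagramOfPath_eq b
  rw [homotopyClass_diagramOfPath, homotopyClass_diagramOfPath] at hab
  exact φ.diagramToRAAG_injective x
    (φ.wordToRAAG_eq_of_homotopic h h' (Path.Homotopic.Quotient.eq.1 hab))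

theorem homotopyClass_surjective {x : X} (hx : K.IsVertex x) :
    Function.Surjective (φ.homotopyClass x) := by
  intro q
  obtain ⟨p, rfl⟩ := Path.Homotopic.Quotient.mk_surjective q
  obtain ⟨γ, h, hh⟩ := isEdgePath hx hx p
  exact ⟨φ.diagramOfPath h, (φ.homotopyClass_diagramOfPath h).trans
    (Path.Homotopic.Quotient.eq.2 hh.symm)⟩

/-- The isomorphism between the diagram group and the fundamental group, multiplied by
concatenation. -/
noncomputable def diagramEquiv {x : X} (hx : K.IsVertex x) :
    φ.Diagram x ≃* (FundamentalGroup X x)ᵐᵒᵖ :=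
  MulEquiv.ofBijective
    ({ toFun := fun a => .op (FundamentalGroup.fromPath (φ.homotopyClass x a))
       map_mul' := fun a b => congrArg (fun q => MulOpposite.op (FundamentalGroup.fromPath q))
        (φ.homotopyClass_mul a b) } : φ.Diagram x →ₙ* (FundamentalGroup X x)ᵐᵒᵖ)
    ⟨fun _ _ h => φ.homotopyClass_injective x (MulOpposite.op_injective h),
      fun q => (φ.homotopyClass_surjective hx q.unop).imp fun _ h => congrArg MulOpposite.op h⟩

theorem diagramEquiv_diagramOfPath {x : X} (hx : K.IsVertex x) {γ : List K.Edge}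
    (h : K.IsPath x γ x) : φ.diagramEquiv hx (φ.diagramOfPath h) =
      .op (FundamentalGroup.fromPath (Path.Homotopic.Quotient.mk h.toPath)) :=
  congrArg (fun q => MulOpposite.op (FundamentalGroup.fromPath q))
    (φ.homotopyClass_diagramOfPath h)

theorem exists_injective_fundamentalGroup (φ : K.SpecialColoring Δ) (p : X) :
    ∃ f : FundamentalGroup X p →* RAAG Δ, Function.Injective f := by
  obtain ⟨x, hx, ⟨q⟩⟩ := exists_path_to_vertex K p
  let e : FundamentalGroup X p ≃* φ.Diagram x :=
    (FundamentalGroup.fundamentalGroupMulEquivOfPath q).trans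
      -- Inversion identifies a group with its opposite, which removes the opposite coming from
      -- concatenation.
      ((MulEquiv.inv' _).trans (φ.diagramEquiv hx).symm)
  exact ⟨(φ.diagramToRAAG x).comp e.toMonoidHom, (φ.diagramToRAAG_injective x).comp e.injective⟩

end SpecialColoring

/-! ### The coloring by the crossing graph -/

theorem OrientedHyperplane.inv_inv (J : K.OrientedHyperplane) : J.inv.inv = J := by
  obtain ⟨e⟩ := J
  exact congrArg Cube.orientedHyperplane
    (Subtype.ext (funext fun t => congrArg e.1 (funext fun i => by simp [rev])))

theorem OrientedHyperplane.toHyperplane_inv (J : K.OrientedHyperplane) :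
    J.inv.toHyperplane = J.toHyperplane := by
  obtain ⟨e⟩ := J
  exact (Quot.sound (.inr rfl)).symm

/-- Parallelism is compatible with reversal, so a chain of parallelisms and reversals only matters
through the parity of its reversals. -/
theorem OrientedHyperplane.toHyperplane_eq_iff {J H : K.OrientedHyperplane} :
    J.toHyperplane = H.toHyperplane ↔ J = H ∨ J = H.inv := by
  constructor
  · obtain ⟨e⟩ := J
    obtain ⟨f⟩ := H
    intro h
    replace h := Quot.eqvGen_exact h
    simp only [id] at h
    change e.orientedHyperplane = f.orientedHyperplane ∨
      e.orientedHyperplane = f.orientedHyperplane.inv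
    induction h with
    | rel e f h =>
      rcases h with h | rfl
      · exact .inl (Quot.sound h)
      · exact .inr (OrientedHyperplane.inv_inv e.orientedHyperplane).symm
    | refl e => exact .inl rfl
    | symm e f _ ih =>
      rcases ih with h | h
      · exact .inl h.symm
      · exact .inr (by rw [h, OrientedHyperplane.inv_inv])
    | trans e f g _ _ ih ih' =>
      rcases ih with h | h <;> rcases ih' with h' | h' <;>
        simp [h, h', OrientedHyperplane.inv_inv]
  · rintro (rfl | rfl)
    · rfl
    · exact H.toHyperplane_inv

theorem OrientedHyperplane.toHyperplane_surjective :
    Function.Surjective (OrientedHyperplane.toHyperplane (K := K)) := by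
  rintro ⟨e⟩
  exact ⟨e.orientedHyperplane, rfl⟩

/-- A choice of an orientation for every hyperplane. -/
noncomputable def orientation (K : CubeComplex X) (H : K.Hyperplane) : K.OrientedHyperplane :=
  Function.surjInv OrientedHyperplane.toHyperplane_surjective H

theorem orientation_toHyperplane (J : K.OrientedHyperplane) :
    K.orientation J.toHyperplane = J ∨ K.orientation J.toHyperplane = J.inv :=
  OrientedHyperplane.toHyperplane_eq_iff.1
    (Function.surjInv_eq OrientedHyperplane.toHyperplane_surjective _)

/-- The color of an oriented hyperplane is the underlying hyperplane, with a sign given by the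
orientation. -/
noncomputable def hyperplaneColor (J : K.OrientedHyperplane) : Color K.Hyperplane :=
  open Classical in (J.toHyperplane, decide (J = K.orientation J.toHyperplane))

theorem hyperplaneColor_injective :
    Function.Injective (hyperplaneColor : K.OrientedHyperplane → Color K.Hyperplane) := by
  intro J H h
  obtain ⟨h1, h2⟩ := Prod.ext_iff.1 h
  change J.toHyperplane = H.toHyperplane at h1
  simp only [hyperplaneColor, decide_eq_decide, h1] at h2
  rcases OrientedHyperplane.toHyperplane_eq_iff.1 h1 with h3 | h3
  · exact h3
  · rcases orientation_toHyperplane H with h4 | h4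
    · exact (h2.2 h4.symm).trans h4
    · exact h3.trans (h4.symm.trans (h2.1 (h3.trans h4.symm)).symm)

/-- Two-sidedness enters here: exactly one of `J` and `J.inv` is the chosen orientation, so the sign
changes. -/
theorem hyperplaneColor_inv {J : K.OrientedHyperplane} (hJ : J.TwoSided) :
    hyperplaneColor J.inv = (hyperplaneColor J).inv := by
  refine Prod.ext J.toHyperplane_inv ?_
  simp only [hyperplaneColor, Color.inv, J.toHyperplane_inv]
  have hJ : J ≠ J.inv := hJ
  rcases orientation_toHyperplane J with h | h
  · simp [J.toHyperplane_inv, h, hJ.symm]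
  · simp [J.toHyperplane_inv, h, hJ]

/-- The coloring of a special cube complex by its hyperplanes. -/
noncomputable def IsSpecial.coloring (hK : K.IsSpecial) : K.SpecialColoring K.crossingGraph where
  φ := hyperplaneColor
  map_inv J := hyperplaneColor_inv (hK.twoSided J)
  adj_of_transverse J H h := by
    refine ⟨fun h' => ?_, h⟩
    change J.toHyperplane = H.toHyperplane at h'
    rw [h'] at h
    exact hK.not_selfIntersecting _ h
  eq_of_color_eq e f hef h := by
    by_contra hne
    -- The two edges are dual to the same oriented hyperplane: it would self-intersect if they
    -- spanned a square, and self-osculate if they did not.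
    have h' := hyperplaneColor_injective h
    have hspan : ¬ K.SpanSquare e f := by
      rintro ⟨q, rfl, rfl⟩
      have : (q.edge 0).hyperplane = (q.edge 1).hyperplane :=
        congrArg OrientedHyperplane.toHyperplane h'
      exact hK.not_selfIntersecting _ ⟨q, rfl, this.symm⟩
    exact hK.not_selfOsculating f.orientedHyperplane ⟨e, f, hne, h', rfl, .inl ⟨hef, hspan⟩⟩
  spanSquare_of_adj e f hef h := by
    by_contra hspan
    exact hK.not_interOsculating e.hyperplane f.hyperplane h.1 ⟨h.2, e, f, rfl, rfl, hef, hspan⟩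

end CubeComplex
end CubeCx

/-! ### The main theorem. -/

theorem mainTheorem8 {X : Type u} [TopologicalSpace X] (K : CubeCx.CubeComplex X)
    (hK : K.IsSpecial) :
    (∀ {V : Type v} (Δ : SimpleGraph V) (φ : K.SpecialColoring Δ),
      (∀ x : X, K.IsVertex x →
        Function.Injective (φ.diagramToRAAG x) ∧
        ∃ Ψ : φ.Diagram x ≃* (FundamentalGroup X x)ᵐᵒᵖ,
          ∀ (γ : List K.Edge) (h : K.IsPath x γ x),
            Ψ (φ.diagramOfPath h) =
              MulOpposite.op (FundamentalGroup.fromPath (Path.Homotopic.Quotient.mk h.toPath))) ∧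
      ∀ p : X, ∃ f : FundamentalGroup X p →* CubeCx.RAAG Δ, Function.Injective f) ∧
    ∀ p : X, ∃ f : FundamentalGroup X p →* CubeCx.RAAG K.crossingGraph, Function.Injective f :=
  ⟨fun _ φ => ⟨fun x hx => ⟨φ.diagramToRAAG_injective x, φ.diagramEquiv hx,
    fun _ h => φ.diagramEquiv_diagramOfPath hx h⟩, φ.exists_injective_fundamentalGroup⟩,
    hK.coloring.exists_injective_fundamentalGroup⟩
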